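/- Let $d\ge 1$ and let $X=(X_i)_{i\in\mathbb Z^d}$ be a real-valued random field with finite second moments whose law is invariant under the translations of $\mathbb Z^d$, with $\mathbf E[X_i]=0$ and $\mathrm{Var}(X_i)=1$ for all $i$, and such that for every finite $A\subset\mathbb Z^d$ the vector $(X_i)_{i\in A}$ has a density $f_A$ on $\mathbb R^{A}$. Let $K(j)=\mathbf E[X_jX_0]$, so that $\mathbf E[X_iX_j]=K(i-j)$, and suppose that $X$ has a structure function $S(\theta)=\sum_{j\in\mathbb Z^d}K(j)e^{i\theta\cdot j}$ on $[-\pi,\pi]^d$, in the sense of Fourier series: $S$ is an integrable function with $K(j)=(2\pi)^{-d}\int_{[-\pi,\pi]^d}e^{-ij\cdot\theta}S(\theta)\,d\theta$ for all $j\in\mathbb Z^d$. Let $\Lambda\subset\mathbb R^d$ be a bounded domain (a nonempty connected open set) with $C^2$ boundary, each connected component of which, suitably oriented, has everywhere positive Gaussian (Gauss–Kronecker) curvature. For $L>0$ put $\Lambda_L=\{Lx: x\in\Lambda\}$ and $\Lambda_L'=\Lambda_L\cap\mathbb Z^d$, and let $$h(X|_{\Lambda_L})=-\int_{\mathbb R^{\Lambda_L'}}f_{\Lambda_L'}(x)\log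 f_{\Lambda_L'}(x)\,dx\in[-\infty,\infty]$$ be the entropy of $(X_i)_{i\in\Lambda_L'}$. 1. If $S$ has a spectral gap, i.e. $S=0$ almost everywhere on some nonempty open subset of $[-\pi,\pi]^d$, then $$\lim_{L\to\infty}\frac{h(X|_{\Lambda_L})}{|\Lambda_L'|}=-\infty .$$ 2. More generally, the same conclusion holds whenever $\log S$ (with $\log 0=-\infty$) is not integrable on $[-\pi,\pi]^d$. -/

import Mathlib

open MeasureTheory ProbabilityTheory Filter Topology

noncomputable section

/-! ### Domains in Euclidean space -/

/-- `ρ` is a local `C²` defining function of `Λ` at the boundary point `p`: it is `C²` near `p`, its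
gradient at `p` does not vanish, and near `p` the set `Λ` is `{ρ < 0}`. -/
structure IsLocalDefiningFunction {d : ℕ} (Λ : Set (EuclideanSpace ℝ (Fin d)))
    (p : EuclideanSpace ℝ (Fin d)) (ρ : EuclideanSpace ℝ (Fin d) → ℝ) : Prop where
  contDiffAt : ContDiffAt ℝ 2 ρ p
  gradient_ne_zero : gradient ρ p ≠ 0
  eventually_iff : ∀ᶠ x in 𝓝 p, (x ∈ Λ ↔ ρ x < 0)

/-- The normalized gradient of `ρ`. If `ρ` is a local defining function of `Λ`, its restriction to
the boundary is the outward unit normal (the Gauss map). -/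
def unitNormal {d : ℕ} (ρ : EuclideanSpace ℝ (Fin d) → ℝ) (x : EuclideanSpace ℝ (Fin d)) :
    EuclideanSpace ℝ (Fin d) :=
  ‖gradient ρ x‖⁻¹ • gradient ρ x

/-- The Gaussian (Gauss–Kronecker) curvature at `p` of a hypersurface with unit normal field `ν`
(extended to a neighbourhood of `p`): the determinant of the Weingarten map, that is, of the
differential of `ν` on the tangent space `(ν p)ᗮ`. The sign is such that a round sphere with its
outward normal has positive curvature. -/
def gaussianCurvature {d : ℕ} (ν : EuclideanSpace ℝ (Fin d) → EuclideanSpace ℝ (Fin d))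
    (p : EuclideanSpace ℝ (Fin d)) : ℝ :=
  LinearMap.det
    ((Submodule.span ℝ {ν p})ᗮ.orthogonalProjectionOnto.toLinearMap ∘ₗ
      (fderiv ℝ ν p).toLinearMap ∘ₗ (Submodule.span ℝ {ν p})ᗮ.subtype)

/-- A bounded domain (nonempty connected open set) with `C²` boundary, every connected component of
which, oriented by one of its two unit normal fields (`σ = 1`: outward, `σ = -1`: inward), has
everywhere positive Gaussian curvature. -/
structure IsPositivelyCurvedDomain {d : ℕ} (Λ : Set (EuclideanSpace ℝ (Fin d))) : Prop where
  isOpen : IsOpen Λ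
  isConnected : IsConnected Λ
  isBounded : Bornology.IsBounded Λ
  boundary_C2 : ∀ p ∈ frontier Λ, ∃ ρ, IsLocalDefiningFunction Λ p ρ
  curvature_pos : ∀ p ∈ frontier Λ, ∃ σ : ℝ, (σ = 1 ∨ σ = -1) ∧
    ∀ q ∈ connectedComponentIn (frontier Λ) p, ∃ ρ, IsLocalDefiningFunction Λ q ρ ∧
      0 < gaussianCurvature (fun x => σ • unitNormal ρ x) q

/-- The lattice point `i ∈ ℤᵈ` as a point of `ℝᵈ`. -/
def latticePoint {d : ℕ} (i : Fin d → ℤ) : EuclideanSpace ℝ (Fin d) :=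
  WithLp.toLp 2 (fun k => (i k : ℝ))

/-- The dilation `Λ_L = {L x : x ∈ Λ}`. -/
def dilate {d : ℕ} (L : ℝ) (Λ : Set (EuclideanSpace ℝ (Fin d))) : Set (EuclideanSpace ℝ (Fin d)) :=
  (fun x => L • x) '' Λ

theorem finite_latticePoint_mem {d : ℕ} {Λ : Set (EuclideanSpace ℝ (Fin d))}
    (hΛ : Bornology.IsBounded Λ) (L : ℝ) : {i | latticePoint i ∈ dilate L Λ}.Finite := by
  obtain ⟨R, hR⟩ := hΛ.exists_norm_le
  refine (Set.finite_Icc (fun _ : Fin d => -⌈|L| * R⌉) (fun _ => ⌈|L| * R⌉)).subset ?_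
  rintro i ⟨x, hx, hxi⟩
  have hn : ‖latticePoint i‖ ≤ |L| * R := by
    rw [← hxi]
    simp only [norm_smul, Real.norm_eq_abs]
    exact mul_le_mul_of_nonneg_left (hR x hx) (abs_nonneg L)
  have hk : ∀ k, |i k| ≤ ⌈|L| * R⌉ := fun k => by
    have h1 : ‖(latticePoint i) k‖ ≤ ‖latticePoint i‖ := PiLp.norm_apply_le _ k
    have h2 : |(i k : ℝ)| ≤ |L| * R := by
      simpa [latticePoint] using h1.trans hn
    have h3 : ((|i k| : ℤ) : ℝ) ≤ (⌈|L| * R⌉ : ℝ) := by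
      rw [Int.cast_abs]; exact h2.trans (Int.le_ceil _)
    exact_mod_cast h3
  exact ⟨fun k => (abs_le.1 (hk k)).1, fun k => (abs_le.1 (hk k)).2⟩

/-- The finite set of sites `Λ_L' = Λ_L ∩ ℤᵈ`, for a bounded set `Λ`. -/
def sites {d : ℕ} (Λ : Set (EuclideanSpace ℝ (Fin d))) (hΛ : Bornology.IsBounded Λ) (L : ℝ) :
    Finset (Fin d → ℤ) :=
  (finite_latticePoint_mem hΛ L).toFinset

/-! ### Random fields on the lattice -/

/-- The law of the field is invariant under all translations of `ℤᵈ`. -/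
def IsTranslationInvariant {d : ℕ} {Ω : Type*} [MeasurableSpace Ω] (X : (Fin d → ℤ) → Ω → ℝ)
    (P : Measure Ω) : Prop :=
  ∀ t : Fin d → ℤ, IdentDistrib (fun ω i => X (i + t) ω) (fun ω i => X i ω) P P

/-- For every finite set `A` of sites, `(X_i)_{i ∈ A}` has a density on `ℝ^A`. -/
def HasJointDensities {d : ℕ} {Ω : Type*} [MeasurableSpace Ω] (X : (Fin d → ℤ) → Ω → ℝ)
    (P : Measure Ω) : Prop :=
  ∀ A : Finset (Fin d → ℤ), HasPDF (fun ω (i : A) => X i ω) P volume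

/-- The covariance kernel `K` of a translation-invariant centred field: `K(j) = E[X_j X_0]`, so that
`E[X_i X_j] = K(i - j)`. -/
def covarianceKernel {d : ℕ} {Ω : Type*} [MeasurableSpace Ω] (X : (Fin d → ℤ) → Ω → ℝ)
    (P : Measure Ω) (j : Fin d → ℤ) : ℝ :=
  ∫ ω, X j ω * X 0 ω ∂P

/-- The box `[-π, π]ᵈ`. -/
def frequencyBox (d : ℕ) : Set (Fin d → ℝ) :=
  Set.Icc (fun _ => -Real.pi) (fun _ => Real.pi)

/-- `S` is the structure function of the kernel `K`, i.e. the Fourier transform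
`S(θ) = ∑_j K(j) e^{i θ·j}` of `K` on `[-π, π]ᵈ`, in the sense of Fourier series: `S` is integrable
and `K(j)` is its `j`-th Fourier coefficient. When `K` is absolutely summable this is the sum of
the series, see `isStructureFunction_tsum` below. -/
structure IsStructureFunction {d : ℕ} (S : (Fin d → ℝ) → ℝ) (K : (Fin d → ℤ) → ℝ) : Prop where
  integrableOn : IntegrableOn S (frequencyBox d) volume
  fourierCoeff_eq : ∀ j : Fin d → ℤ,
    (1 / (2 * (Real.pi : ℂ)) ^ d) *
      ∫ θ in frequencyBox d, Complex.exp (-(Complex.I * ∑ k, (j k : ℂ) * (θ k : ℂ))) * (S θ : ℂ)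
    = (K j : ℂ)

theorem integral_box_exp {d : ℕ} (m : Fin d → ℤ) :
    ∫ θ in frequencyBox d, Complex.exp (Complex.I * ∑ k, (m k : ℂ) * (θ k : ℂ))
      = if m = 0 then (2 * (Real.pi : ℂ)) ^ d else 0 := by
  have h1 : ∀ n : ℤ, ∫ x in Set.Icc (-Real.pi) Real.pi, Complex.exp (Complex.I * ((n : ℂ) * (x : ℂ)))
      = if n = 0 then 2 * (Real.pi : ℂ) else 0 := by
    intro n
    rw [integral_Icc_eq_integral_Ioc,
      ← intervalIntegral.integral_of_le (by linarith [Real.pi_pos])]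
    split_ifs with hn
    · subst hn
      simp only [Int.cast_zero, zero_mul, mul_zero, Complex.exp_zero,
        intervalIntegral.integral_const, Complex.real_smul]
      push_cast; ring
    · have hc : Complex.I * (n : ℂ) ≠ 0 := mul_ne_zero Complex.I_ne_zero (by exact_mod_cast hn)
      have := integral_exp_mul_complex (a := -Real.pi) (b := Real.pi) hc
      simp only [mul_assoc] at this
      rw [this]
      have e : Complex.exp (Complex.I * ((n : ℂ) * (Real.pi : ℂ)))
          = Complex.exp (Complex.I * ((n : ℂ) * ((-Real.pi : ℝ) : ℂ))) := by
        rw [Complex.exp_eq_exp_iff_exists_int]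
        exact ⟨n, by push_cast; ring⟩
      rw [e, sub_self, zero_div]
  have h2 : (volume : Measure (Fin d → ℝ)).restrict (frequencyBox d)
      = Measure.pi fun _ => volume.restrict (Set.Icc (-Real.pi) Real.pi) := by
    rw [frequencyBox, ← Set.pi_univ_Icc, volume_pi, Measure.restrict_pi_pi]
  rw [h2]
  simp only [Finset.mul_sum, Complex.exp_sum]
  rw [integral_fintype_prod_eq_prod (𝕜 := ℂ)
    (fun k (x : ℝ) => Complex.exp (Complex.I * ((m k : ℂ) * (x : ℂ))))]
  simp only [h1]
  split_ifs with hm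
  · subst hm; simp
  · obtain ⟨k, hk⟩ := Function.ne_iff.1 hm
    exact Finset.prod_eq_zero (Finset.mem_univ k) (if_neg hk)

/-- If `K` is absolutely summable, the sum `S(θ)` of the series `∑_j K(j) e^{i θ·j}` (a real
number, as covariance kernels are even) is a structure function of `K`. -/
theorem isStructureFunction_tsum {d : ℕ} (S : (Fin d → ℝ) → ℝ) (K : (Fin d → ℤ) → ℝ)
    (hK : Summable K)
    (hS : ∀ θ, (S θ : ℂ) = ∑' j, Complex.exp (Complex.I * ∑ k, (j k : ℂ) * (θ k : ℂ)) * (K j : ℂ)) :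
    IsStructureFunction S K := by
  have hfin : volume (frequencyBox d) ≠ ⊤ := isCompact_Icc.measure_lt_top.ne
  have : IsFiniteMeasure ((volume : Measure (Fin d → ℝ)).restrict (frequencyBox d)) :=
    ⟨by simpa using hfin.lt_top⟩
  have hn : ∀ (j : Fin d → ℤ) (θ : Fin d → ℝ),
      ‖Complex.exp (Complex.I * ∑ k, (j k : ℂ) * (θ k : ℂ))‖ = 1 := by
    intro j θ
    have : Complex.I * ∑ k, (j k : ℂ) * (θ k : ℂ) = ((∑ k, (j k : ℝ) * θ k : ℝ) : ℂ) * Complex.I := by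
      push_cast; ring
    rw [this, Complex.norm_exp_ofReal_mul_I]
  have hcS : Continuous fun θ => (S θ : ℂ) := by
    simp only [hS]
    refine continuous_tsum (fun j => by fun_prop) hK.norm (fun j θ => ?_)
    rw [norm_mul, hn, one_mul, Complex.norm_real]
  have hcS' : Continuous S := by
    exact Complex.continuous_re.comp hcS
  refine ⟨hcS'.continuousOn.integrableOn_compact isCompact_Icc, fun j => ?_⟩
  have key : ∫ θ in frequencyBox d,
      Complex.exp (-(Complex.I * ∑ k, (j k : ℂ) * (θ k : ℂ))) * (S θ : ℂ)
      = ∑' i, ∫ θ in frequencyBox d,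
        Complex.exp (Complex.I * ∑ k, ((i - j) k : ℂ) * (θ k : ℂ)) * (K i : ℂ) := by
    rw [integral_tsum_of_summable_integral_norm]
    · congr 1
      ext θ
      rw [hS, ← tsum_mul_left]
      congr 1
      ext i
      rw [← mul_assoc, ← Complex.exp_add]
      congr 2
      simp only [Pi.sub_apply, Int.cast_sub, sub_mul, Finset.sum_sub_distrib]
      ring
    · intro i
      refine Continuous.integrableOn_Icc ?_
      fun_prop
    · have : ∀ i : Fin d → ℤ, ∫ θ in frequencyBox d,
          ‖Complex.exp (Complex.I * ∑ k, ((i - j) k : ℂ) * (θ k : ℂ)) * (K i : ℂ)‖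
          = volume.real (frequencyBox d) * |K i| := by
        intro i
        simp [hn (i - j), -Pi.sub_apply]
      simp only [this]
      exact hK.abs.mul_left _
  rw [key]
  simp only [integral_mul_const]
  have hI : ∀ i : Fin d → ℤ, (∫ θ in frequencyBox d,
      Complex.exp (Complex.I * ∑ k, ((i - j) k : ℂ) * (θ k : ℂ))) * (K i : ℂ)
      = if i = j then (2 * (Real.pi : ℂ)) ^ d * (K j : ℂ) else 0 := by
    intro i
    rw [integral_box_exp (i - j)]
    simp only [sub_eq_zero]
    split_ifs with h
    · rw [h]
    · simp
  simp only [hI, tsum_ite_eq]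
  have : (2 * (Real.pi : ℂ)) ^ d ≠ 0 := by
    apply pow_ne_zero
    simp [Real.pi_ne_zero]
  field_simp

/-- `S` has a spectral gap: it vanishes (almost everywhere) on a nonempty open subset of the
frequency domain. -/
def HasSpectralGap {d : ℕ} (S : (Fin d → ℝ) → ℝ) : Prop :=
  ∃ U : Set (Fin d → ℝ), IsOpen U ∧ U.Nonempty ∧ U ⊆ frequencyBox d ∧
    ∀ᵐ θ ∂(volume.restrict U), S θ = 0

/-- `log S` is integrable on `[-π, π]ᵈ`, where `log 0 = -∞`; positivity has to be required almost
everywhere because of the convention `Real.log 0 = 0`. -/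
def IsLogIntegrable {d : ℕ} (S : (Fin d → ℝ) → ℝ) : Prop :=
  (∀ᵐ θ ∂(volume.restrict (frequencyBox d)), 0 < S θ) ∧
    IntegrableOn (fun θ => Real.log (S θ)) (frequencyBox d) volume

/-! ### Entropy -/

/-- The integral of a real function with values in `[-∞, ∞]`: the integral of the positive part
minus that of the negative part. -/
def extendedIntegral {α : Type*} [MeasurableSpace α] (g : α → ℝ) (ν : Measure α) : EReal :=
  ((∫⁻ x, ENNReal.ofReal (g x) ∂ν : ENNReal) : EReal) -
    ((∫⁻ x, ENNReal.ofReal (-g x) ∂ν : ENNReal) : EReal)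

/-- The entropy `h(X|_A) = -∫ f log f` of the field on the finite set of sites `A`, with `f` the
joint density of `(X_i)_{i ∈ A}`. It is `[-∞, ∞]`-valued, since `f log f` need not be integrable. -/
def fieldEntropy {d : ℕ} {Ω : Type*} [MeasurableSpace Ω] (X : (Fin d → ℤ) → Ω → ℝ)
    (P : Measure Ω) (A : Finset (Fin d → ℤ)) : EReal :=
  -extendedIntegral
    (fun x : A → ℝ =>
      (pdf (fun ω (i : A) => X i ω) P volume x).toReal *
        Real.log (pdf (fun ω (i : A) => X i ω) P volume x).toReal)
    volume

end

/-!
Among all fields with given second moments, the Gaussian one has the largest entropy, so the claim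
comes down to the covariance matrices `C` of the field on `Λ_L'`, which are Toeplitz matrices with
symbol `S`. No determinant of `C` is needed, because it is enough to compare the field with
a suitable Gaussian one. For a trigonometric polynomial `w > 0`, let `T` be the Toeplitz matrix of
`w` on the set of sites `A`. Gibbs' inequality relative to the centred Gaussian density with
precision matrix `T` gives (`fieldEntropy_le_of_symbol`)

  `h(X|_A) ≤ (|A| log 2π - log det T + tr (C T)) / 2`.

Jensen's inequality in an eigenbasis of `T` shows `log det T ≥ |A| ∫ log w` for every `A`
(`card_mul_integral_log_le_log_det_toeplitz`), integrals being with respect to the uniform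
probability measure on `[-π, π]ᵈ`. The trace is a finite combination of the numbers
`|A ∩ (A + m)|`, and for `A = Λ_L'` each of these is asymptotically `|A|`, since the boundary of
`Λ` is a null set (`tendsto_card_inter_translate_div_card`). Hence `tr (C T) / |A| → ∫ S w`
(`IsStructureFunction.tendsto_toeplitz_trace_div_card`), and the limit superior of the entropy per
site is at most

  `(log 2π + ∫ S w - ∫ log w) / 2`.

It remains to choose `w`. For `w = 1 + 1 / (S⁺ + ε)` one has `∫ S w - ∫ log w ≤ ∫ |S| + 1 +
∫ log (S⁺ + ε)`, and the last integral tends to `-∞` as `ε → 0` if `log S` is not integrable. This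
`w` can be replaced by a trigonometric polynomial, by density in `L¹((1 + |S|) dθ)` and the
Stone–Weierstrass theorem (`exists_trigPolynomial_integral_le`). A spectral gap is a special case,
since then `S` is not almost everywhere positive.
-/

noncomputable section

/-! ### Lattice points in dilated domains -/

/-- An open set with `C²` boundary has a Lebesgue-null boundary. By the Lebesgue density theorem it
suffices that no boundary point is a density point of the boundary, and indeed every small ball
around a boundary point contains a ball of a quarter of its radius that lies inside the set. -/
theorem volume_frontier_eq_zero {d : ℕ} {Λ : Set (EuclideanSpace ℝ (Fin d))} (ho : IsOpen Λ)
    (h : ∀ p ∈ frontier Λ, ∃ ρ, IsLocalDefiningFunction Λ p ρ) : volume (frontier Λ) = 0 := by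
  by_contra hne
  have hae := Besicovitch.ae_tendsto_measure_inter_div volume (frontier Λ)
  have hnb : (ae (volume.restrict (frontier Λ))).NeBot := by
    rw [ae_neBot]
    rwa [Ne, Measure.restrict_eq_zero]
  obtain ⟨p, hlim, hp⟩ :=
    (hae.and (ae_restrict_mem isClosed_frontier.measurableSet)).exists
  obtain ⟨ρ, hρ⟩ := h p hp
  have hdiff : DifferentiableAt ℝ ρ p := hρ.contDiffAt.differentiableAt (by norm_num)
  have hg := hdiff.hasGradientAt
  set g := gradient ρ p with hgdef
  have hg0 : 0 < ‖g‖ := norm_pos_iff.2 hρ.gradient_ne_zero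
  have hρp : ρ p ≤ 0 := by
    by_contra! hpos
    have h1 : ∀ᶠ x in 𝓝 p, 0 < ρ x := hdiff.continuousAt.eventually_const_lt hpos
    have h2 : ∀ᶠ x in 𝓝 p, x ∉ Λ := by
      filter_upwards [h1, hρ.eventually_iff] with x hx hx'
      rw [hx']; exact not_lt.2 hx.le
    have h3 := mem_closure_iff_frequently.1 (frontier_subset_closure hp)
    exact h3 h2
  have hev := (hasGradientAt_iff_isLittleO.1 hg).bound (c := ‖g‖ / 4) (by positivity)
  obtain ⟨δ, hδ, hball⟩ := Metric.eventually_nhds_iff_ball.1 (hev.and hρ.eventually_iff)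
  set u : EuclideanSpace ℝ (Fin d) := ‖g‖⁻¹ • g with hu
  have hun : ‖u‖ = 1 := by
    rw [hu, norm_smul, norm_inv, norm_norm, inv_mul_cancel₀ hg0.ne']
  have hgu : inner ℝ g u = ‖g‖ := by
    rw [hu, inner_smul_right, real_inner_self_eq_norm_sq]; field_simp
  -- the ball of radius `r / 4` around `p - (r / 2) u` lies in `Λ`, hence misses the frontier
  have hsub : ∀ r : ℝ, 0 < r → r < δ → ∀ x ∈ Metric.closedBall (p - (r / 2) • u) (r / 4),
      x ∈ Metric.closedBall p r ∧ x ∈ Λ := by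
    intro r hr hrδ x hx
    obtain ⟨z, hz⟩ : ∃ z, z = x - (p - (r / 2) • u) := ⟨_, rfl⟩
    have hzn : ‖z‖ ≤ r / 4 := by rw [hz, ← dist_eq_norm]; exact hx
    have hxp : x - p = z - (r / 2) • u := by rw [hz]; abel
    have hn : ‖x - p‖ ≤ 3 * r / 4 := by
      rw [hxp]
      refine (norm_sub_le _ _).trans ?_
      rw [norm_smul, hun, Real.norm_of_nonneg (by positivity)]
      linarith
    have hxb : x ∈ Metric.ball p δ := by
      rw [Metric.mem_ball, dist_eq_norm]; linarith
    obtain ⟨h1, h2⟩ := hball x hxb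
    refine ⟨?_, ?_⟩
    · rw [Metric.mem_closedBall, dist_eq_norm]; linarith
    · rw [h2]
      have h3 : inner ℝ g (x - p) ≤ - (‖g‖ * r / 4) := by
        rw [hxp, inner_sub_right, inner_smul_right, hgu]
        have := real_inner_le_norm g z
        nlinarith
      have h4 := (abs_le.1 (Real.norm_eq_abs _ ▸ h1)).2
      have h5 : ‖g‖ / 4 * ‖x - p‖ ≤ ‖g‖ / 4 * (3 * r / 4) := by gcongr
      nlinarith
  have hle : ∀ᶠ r in 𝓝[>] (0 : ℝ),
      volume (frontier Λ ∩ Metric.closedBall p r) / volume (Metric.closedBall p r)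
        + ENNReal.ofReal ((1 / 4) ^ d) ≤ 1 := by
    filter_upwards [Ioo_mem_nhdsGT hδ] with r hr
    have hv0 : volume (Metric.closedBall p r) ≠ 0 :=
      (Metric.measure_closedBall_pos volume p hr.1).ne'
    have hvt : volume (Metric.closedBall p r) ≠ ⊤ := measure_closedBall_lt_top.ne
    have hsmall : volume (Metric.closedBall (p - (r / 2) • u) (r / 4))
        = ENNReal.ofReal ((1 / 4) ^ d) * volume (Metric.closedBall p r) := by
      rw [show r / 4 = 1 / 4 * r by ring, Measure.addHaar_closedBall_mul _ _ (by norm_num) hr.1.le,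
        Measure.addHaar_closedBall_center volume p]
      simp
    have hdisj : Disjoint (frontier Λ ∩ Metric.closedBall p r)
        (Metric.closedBall (p - (r / 2) • u) (r / 4)) := by
      rw [Set.disjoint_left]
      intro x hx hx'
      have := (hsub r hr.1 hr.2 x hx').2
      rw [ho.frontier_eq] at hx
      exact hx.1.2 this
    have hu : volume (frontier Λ ∩ Metric.closedBall p r)
        + volume (Metric.closedBall (p - (r / 2) • u) (r / 4)) ≤ volume (Metric.closedBall p r) := by
      rw [← measure_union hdisj Metric.isClosed_closedBall.measurableSet]
      exact measure_mono (Set.union_subset Set.inter_subset_right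
        fun x hx => (hsub r hr.1 hr.2 x hx).1)
    rw [hsmall] at hu
    have := ENNReal.div_le_div_right hu (volume (Metric.closedBall p r))
    rwa [ENNReal.add_div, ENNReal.mul_div_cancel_right hv0 hvt, ENNReal.div_self hv0 hvt] at this
  have hl := le_of_tendsto (hlim.add_const (ENNReal.ofReal ((1 / 4) ^ d))) hle
  have : (0 : ENNReal) < ENNReal.ofReal ((1 / 4) ^ d) := by simp
  exact absurd hl (not_le.2 (ENNReal.lt_add_right ENNReal.one_ne_top this.ne'))

theorem mem_sites_iff {d : ℕ} {Λ : Set (EuclideanSpace ℝ (Fin d))}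
    (hb : Bornology.IsBounded Λ) {L : ℝ} (hL : 0 < L) (i : Fin d → ℤ) :
    i ∈ sites Λ hb L ↔ L⁻¹ • latticePoint i ∈ Λ := by
  simp only [sites, dilate, Set.Finite.mem_toFinset, Set.mem_ofPred_eq, Set.mem_image]
  constructor
  · rintro ⟨x, hx, h⟩
    rw [← h, smul_smul, inv_mul_cancel₀ hL.ne', one_smul]; exact hx
  · intro h
    exact ⟨_, h, by rw [smul_smul, mul_inv_cancel₀ hL.ne', one_smul]⟩

theorem floor_eq_iff_mem_Ico {L : ℝ} (hL : 0 < L) (x : ℝ) (n : ℤ) :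
    ⌊L * x⌋ = n ↔ x ∈ Set.Ico ((n : ℝ) / L) ((n + 1) / L) := by
  rw [Int.floor_eq_iff, Set.mem_Ico, div_le_iff₀ hL, lt_div_iff₀ hL, mul_comm L x]

/-- The points of `ℝᵈ` that are rounded down to a site of `L⁻¹ F` have volume `|F| / Lᵈ`. -/
theorem volume_floor_mem {d : ℕ} (F : Finset (Fin d → ℤ)) {L : ℝ} (hL : 0 < L) :
    MeasurableSet {x : Fin d → ℝ | (fun k => ⌊L * x k⌋) ∈ F} ∧
    volume {x : Fin d → ℝ | (fun k => ⌊L * x k⌋) ∈ F} = ENNReal.ofReal (F.card / L ^ d) := by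
  have hset : {x : Fin d → ℝ | (fun k => ⌊L * x k⌋) ∈ F}
      = ⋃ i ∈ F, Set.univ.pi fun k => Set.Ico ((i k : ℝ) / L) ((i k + 1) / L) := by
    ext x
    simp only [Set.mem_ofPred_eq, Set.mem_iUnion, Set.mem_univ_pi, ← floor_eq_iff_mem_Ico hL,
      exists_prop]
    constructor
    · intro h; exact ⟨_, h, fun k => rfl⟩
    · rintro ⟨i, hi, h⟩
      rwa [show (fun k => ⌊L * x k⌋) = i from funext h]
  have hm : ∀ i : Fin d → ℤ,
      MeasurableSet (Set.univ.pi fun k => Set.Ico ((i k : ℝ) / L) ((i k + 1) / L)) :=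
    fun i => MeasurableSet.univ_pi fun k => measurableSet_Ico
  rw [hset]
  refine ⟨F.measurableSet_biUnion fun i _ => hm i, ?_⟩
  rw [measure_biUnion_finset _ fun i _ => hm i]
  · have : ∀ i : Fin d → ℤ,
        volume (Set.univ.pi fun k => Set.Ico ((i k : ℝ) / L) ((i k + 1) / L))
          = ENNReal.ofReal (1 / L ^ d) := by
      intro i
      rw [Real.volume_pi_Ico, ← ENNReal.ofReal_prod_of_nonneg]
      · congr 1
        have : ∀ k, ((i k : ℝ) + 1) / L - i k / L = 1 / L := fun k => by ring
        simp [this]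
      · intro k _
        have : ((i k : ℝ) + 1) / L - i k / L = 1 / L := by ring
        rw [this]; positivity
    simp only [this, Finset.sum_const, nsmul_eq_mul]
    rw [← ENNReal.ofReal_natCast, ← ENNReal.ofReal_mul (by positivity)]
    congr 1; ring
  · intro i _ j _ hij
    rw [Function.onFun, Set.disjoint_left]
    intro x hx hx'
    simp only [Set.mem_univ_pi, ← floor_eq_iff_mem_Ico hL] at hx hx'
    exact hij (funext fun k => (hx k).symm.trans (hx' k))

theorem tendsto_floor_mul_div (x : ℝ) (m : ℤ) :
    Tendsto (fun L : ℝ => L⁻¹ * ((⌊L * x⌋ - m : ℤ) : ℝ)) atTop (𝓝 x) := by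
  have h1 : Tendsto (fun L : ℝ => x - (1 + |(m : ℝ)|) * L⁻¹) atTop (𝓝 x) := by
    simpa using (tendsto_inv_atTop_zero.const_mul (1 + |(m : ℝ)|)).const_sub x
  have h2 : Tendsto (fun L : ℝ => x + (1 + |(m : ℝ)|) * L⁻¹) atTop (𝓝 x) := by
    simpa using (tendsto_inv_atTop_zero.const_mul (1 + |(m : ℝ)|)).const_add x
  refine tendsto_of_tendsto_of_tendsto_of_le_of_le' h1 h2 ?_ ?_ <;>
  · filter_upwards [eventually_gt_atTop 0] with L hL
    have a := Int.floor_le (L * x)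
    have b := Int.lt_floor_add_one (L * x)
    have c := neg_abs_le (m : ℝ)
    have c' := le_abs_self (m : ℝ)
    have hx : x = L⁻¹ * (L * x) := by field_simp
    have hi : 0 < L⁻¹ := inv_pos.2 hL
    push_cast
    nlinarith

/-- The number of sites `i` with `i` and `i - m` both in `Λ_L` is asymptotic to `Lᵈ |Λ|`: divided by
`Lᵈ`, it is the volume of the set of points `x` for which `⌊L x⌋ / L` and `(⌊L x⌋ - m) / L` lie in
`Λ`, and away from the null boundary this holds for all large `L` if and only if `x ∈ Λ`. -/
theorem tendsto_card_sites_inter_translate {d : ℕ} {Λ : Set (EuclideanSpace ℝ (Fin d))}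
    (ho : IsOpen Λ) (hb : Bornology.IsBounded Λ) (hf : volume (frontier Λ) = 0) (m : Fin d → ℤ) :
    Tendsto (fun L : ℝ =>
      (((sites Λ hb L).filter fun i => i - m ∈ sites Λ hb L).card : ℝ) / L ^ d) atTop
      (𝓝 (volume.real Λ)) := by
  set F : ℝ → Finset (Fin d → ℤ) :=
    fun L => (sites Λ hb L).filter fun i => i - m ∈ sites Λ hb L with hF
  set As : ℝ → Set (Fin d → ℝ) := fun L => {x | (fun k => ⌊L * x k⌋) ∈ F L} with hAs
  set T : Set (Fin d → ℝ) := WithLp.toLp 2 ⁻¹' Λ with hT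
  have hmp : MeasurePreserving (WithLp.toLp 2 : (Fin d → ℝ) → EuclideanSpace ℝ (Fin d)) :=
    PiLp.volume_preserving_toLp (Fin d)
  have hTm : MeasurableSet T := hmp.measurable ho.measurableSet
  have hTv : volume T = volume Λ := hmp.measure_preimage ho.measurableSet.nullMeasurableSet
  have hmem : ∀ L : ℝ, 0 < L → ∀ x, x ∈ As L ↔
      (L⁻¹ • latticePoint (fun k => ⌊L * x k⌋ - 0) ∈ Λ ∧
        L⁻¹ • latticePoint (fun k => ⌊L * x k⌋ - m k) ∈ Λ) := by
    intro L hL x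
    simp only [hAs, hF, Set.mem_ofPred_eq, Finset.mem_filter, mem_sites_iff hb hL, sub_zero]
    rfl
  have hpt : ∀ (x : Fin d → ℝ) (m : Fin d → ℤ), Tendsto
      (fun L : ℝ => L⁻¹ • latticePoint (fun k => ⌊L * x k⌋ - m k)) atTop
      (𝓝 (WithLp.toLp 2 x)) := by
    intro x m
    have : Tendsto (fun L : ℝ => fun k => L⁻¹ * ((⌊L * x k⌋ - m k : ℤ) : ℝ)) atTop (𝓝 x) :=
      tendsto_pi_nhds.2 fun k => tendsto_floor_mul_div (x k) (m k)
    exact ((PiLp.continuous_toLp 2 (fun _ : Fin d => ℝ)).tendsto x).comp this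
  obtain ⟨R, hR⟩ := hb.exists_norm_le
  -- `max L 1` only serves to have a positive scale for every value of the parameter
  have key : Tendsto (fun L : ℝ => volume (As (max L 1))) atTop (𝓝 (volume T)) := by
    have hpos : ∀ L : ℝ, 0 < max L 1 := fun L => lt_max_of_lt_right one_pos
    have hmax : Tendsto (fun L : ℝ => max L 1) atTop atTop :=
      tendsto_atTop_mono (fun L => le_max_left L 1) tendsto_id
    refine tendsto_measure_of_ae_tendsto_indicator (B := Set.Icc (fun _ => -R) (fun _ => R + 1))
      atTop hTm (fun L => (volume_floor_mem _ (hpos L)).1) measurableSet_Icc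
      isCompact_Icc.measure_lt_top.ne ?_ ?_
    · refine Eventually.of_forall fun L x hx => ?_
      have hx1 := ((hmem _ (hpos L) x).1 hx).1
      have hk : ∀ k, -R ≤ x k ∧ x k ≤ R + 1 := by
        intro k
        have h1 := (PiLp.norm_apply_le _ k).trans (hR _ hx1)
        simp only [latticePoint, sub_zero, PiLp.smul_apply, smul_eq_mul, Real.norm_eq_abs] at h1
        have h2 := abs_le.1 h1
        have a := Int.floor_le (max L 1 * x k)
        have b := Int.lt_floor_add_one (max L 1 * x k)
        have hi : 0 < (max L 1)⁻¹ := inv_pos.2 (hpos L)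
        have hi1 : (max L 1)⁻¹ ≤ 1 := inv_le_one_of_one_le₀ (le_max_right _ _)
        have hx : x k = (max L 1)⁻¹ * (max L 1 * x k) := by
          rw [← mul_assoc, inv_mul_cancel₀ (hpos L).ne', one_mul]
        constructor <;> nlinarith
      exact ⟨fun k => (hk k).1, fun k => (hk k).2⟩
    · have hae : ∀ᵐ x : Fin d → ℝ, WithLp.toLp 2 x ∉ frontier Λ := by
        have := hmp.measure_preimage (s := frontier Λ) isClosed_frontier.measurableSet.nullMeasurableSet
        rw [hf] at this
        exact measure_eq_zero_iff_ae_notMem.1 this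
      filter_upwards [hae] with x hx
      have h0 := (hpt x 0).comp hmax
      have h1 := (hpt x m).comp hmax
      by_cases hxΛ : WithLp.toLp 2 x ∈ Λ
      · filter_upwards [h0.eventually (ho.mem_nhds hxΛ), h1.eventually (ho.mem_nhds hxΛ)]
          with L hL0 hL1
        rw [hmem _ (hpos L)]
        exact ⟨fun _ => hxΛ, fun _ => ⟨hL0, hL1⟩⟩
      · have hxc : WithLp.toLp 2 x ∉ closure Λ := fun hc =>
          hx (by rw [ho.frontier_eq]; exact ⟨hc, hxΛ⟩)
        filter_upwards [h0.eventually (isClosed_closure.isOpen_compl.mem_nhds hxc)] with L hL0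
        rw [hmem _ (hpos L)]
        exact ⟨fun h => absurd (subset_closure h.1) hL0, fun h => absurd h hxΛ⟩
  rw [hTv] at key
  have hfin : volume Λ ≠ ⊤ := hb.measure_lt_top.ne
  refine ((ENNReal.tendsto_toReal hfin).comp key).congr' ?_
  filter_upwards [eventually_ge_atTop 1] with L hL
  have hL0 : 0 < L := by linarith
  simp only [Function.comp, max_eq_left hL, hAs]
  rw [(volume_floor_mem (F L) hL0).2, ENNReal.toReal_ofReal (by positivity)]

/-- The sets of sites `Λ_L'` form a Følner family: asymptotically they are invariant under every
translation of the lattice. -/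
theorem tendsto_card_inter_translate_div_card {d : ℕ} {Λ : Set (EuclideanSpace ℝ (Fin d))}
    (ho : IsOpen Λ) (hne : Λ.Nonempty) (hb : Bornology.IsBounded Λ)
    (hf : volume (frontier Λ) = 0) :
    (∀ᶠ L in atTop, 0 < (sites Λ hb L).card) ∧ ∀ m : Fin d → ℤ, Tendsto (fun L : ℝ =>
      (((sites Λ hb L).filter fun i => i - m ∈ sites Λ hb L).card : ℝ) / (sites Λ hb L).card) atTop
      (𝓝 1) := by
  have hv : 0 < volume.real Λ :=
    ENNReal.toReal_pos (ho.measure_pos volume hne).ne' hb.measure_lt_top.ne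
  have h0 : Tendsto (fun L : ℝ => ((sites Λ hb L).card : ℝ) / L ^ d) atTop
      (𝓝 (volume.real Λ)) := by
    have := tendsto_card_sites_inter_translate ho hb hf 0
    simpa [Finset.filter_true_of_mem] using this
  refine ⟨?_, fun m => ?_⟩
  · filter_upwards [h0.eventually_const_lt hv] with L hL
    refine Nat.pos_of_ne_zero fun h => ?_
    rw [h] at hL; simp at hL
  · have := (tendsto_card_sites_inter_translate ho hb hf m).div h0 hv.ne'
    rw [div_self hv.ne'] at this
    refine this.congr' ?_
    filter_upwards [eventually_gt_atTop 0] with L hL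
    simp only [Pi.div_apply]
    rw [div_div_div_cancel_right₀ (by positivity)]

/-! ### Entropy is bounded by Gaussian cross entropy -/

theorem integrable_and_integral_exp_neg_sum_sq {ι : Type*} [Fintype ι] :
    Integrable (fun x : ι → ℝ => Real.exp (-(∑ i, x i ^ 2) / 2)) ∧
    ∫ x : ι → ℝ, Real.exp (-(∑ i, x i ^ 2) / 2)
      = Real.exp (Fintype.card ι / 2 * Real.log (2 * Real.pi)) := by
  have h : (fun x : ι → ℝ => Real.exp (-(∑ i, x i ^ 2) / 2))
      = fun x => ∏ i, Real.exp (-(1 / 2) * x i ^ 2) := by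
    ext x
    rw [← Real.exp_sum]
    congr 1
    rw [← Finset.mul_sum]; ring
  rw [h]
  refine ⟨Integrable.fintype_prod (f := fun _ (y : ℝ) => Real.exp (-(1 / 2) * y ^ 2))
    fun i => integrable_exp_neg_mul_sq (by norm_num), ?_⟩
  rw [integral_fintype_prod_volume_eq_prod (fun _ (y : ℝ) => Real.exp (-(1 / 2) * y ^ 2))]
  simp only [integral_gaussian, Finset.prod_const, Finset.card_univ]
  have hp : (0 : ℝ) < 2 * Real.pi := by positivity
  rw [show Real.pi / (1 / 2) = 2 * Real.pi by ring, Real.sqrt_eq_rpow, Real.rpow_def_of_pos hp,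
    ← Real.exp_nat_mul]
  congr 1; ring

theorem integrable_and_integral_exp_neg_sum_mulVec_sq {ι : Type*} [Fintype ι] [DecidableEq ι]
    {B : Matrix ι ι ℝ} (hB : B.det ≠ 0) :
    Integrable (fun x : ι → ℝ => Real.exp (-(∑ i, (B.mulVec x) i ^ 2) / 2)) ∧
    ∫ x : ι → ℝ, Real.exp (-(∑ i, (B.mulVec x) i ^ 2) / 2)
      = Real.exp (Fintype.card ι / 2 * Real.log (2 * Real.pi) - Real.log |B.det|) := by
  have hmap := Real.map_matrix_volume_pi_eq_smul_volume_pi hB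
  have hmeas : Measurable (Matrix.toLin' B) :=
    (LinearMap.continuous_of_finiteDimensional _).measurable
  obtain ⟨h1, h2⟩ := integrable_and_integral_exp_neg_sum_sq (ι := ι)
  have h1' : Integrable (fun x : ι → ℝ => Real.exp (-(∑ i, x i ^ 2) / 2))
      (Measure.map (Matrix.toLin' B) volume) := by
    rw [hmap]; exact h1.smul_measure ENNReal.ofReal_ne_top
  constructor
  · exact h1'.comp_measurable hmeas
  · have := integral_map hmeas.aemeasurable h1'.aestronglyMeasurable
    simp only [Matrix.toLin'_apply] at this
    rw [← this, hmap, integral_smul_measure, h2, ENNReal.toReal_ofReal (abs_nonneg _), smul_eq_mul,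
      Real.exp_sub, Real.exp_log (abs_pos.2 hB), abs_inv]
    field_simp

/-- Gibbs' inequality: the entropy of a density `f` is at most its cross entropy relative to the
(sub)probability density `exp (-U)`. As the cross entropy is finite, the negative part of
`f log f` has a finite integral, so that the difference in `extendedIntegral` is never `∞ - ∞`. -/
theorem neg_extendedIntegral_mul_log_le {α : Type*} [MeasurableSpace α] {ν : Measure α}
    {f U : α → ℝ} (hf0 : ∀ x, 0 ≤ f x) (hf : Integrable f ν) (hf1 : ∫ x, f x ∂ν = 1)
    (hfU : Integrable (fun x => f x * U x) ν) (hq : Integrable (fun x => Real.exp (-U x)) ν)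
    (hq1 : ∫ x, Real.exp (-U x) ∂ν ≤ 1) :
    -extendedIntegral (fun x => f x * Real.log (f x)) ν ≤ ((∫ x, f x * U x ∂ν : ℝ) : EReal) := by
  have hpt : ∀ x, -(f x * Real.log (f x)) ≤ f x * U x + Real.exp (-U x) - f x := by
    intro x
    rcases (hf0 x).eq_or_lt with h | h
    · rw [← h]; simp [Real.exp_nonneg]
    · have h1 := Real.log_le_sub_one_of_pos (div_pos (Real.exp_pos (-U x)) h)
      rw [Real.log_div (Real.exp_pos _).ne' h.ne', Real.log_exp] at h1
      have h2 := mul_le_mul_of_nonneg_left h1 h.le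
      have h3 : f x * (Real.exp (-U x) / f x - 1) = Real.exp (-U x) - f x := by
        field_simp
      rw [h3] at h2
      nlinarith
  have hR : Integrable (fun x => f x * U x + Real.exp (-U x) - f x) ν := (hfU.add hq).sub hf
  have hgm : AEStronglyMeasurable (fun x => f x * Real.log (f x)) ν :=
    (hf.aemeasurable.mul hf.aemeasurable.log).aestronglyMeasurable
  have hN : ∫⁻ x, ENNReal.ofReal (-(f x * Real.log (f x))) ∂ν ≠ ⊤ :=
    ((lintegral_mono fun x => ENNReal.ofReal_le_ofReal (hpt x)).trans_lt
      hR.lintegral_lt_top).ne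
  by_cases hP : ∫⁻ x, ENNReal.ofReal (f x * Real.log (f x)) ∂ν = ⊤
  · rw [extendedIntegral, hP]
    lift ∫⁻ x, ENNReal.ofReal (-(f x * Real.log (f x))) ∂ν to NNReal using hN with N
    have : ((⊤ : ENNReal) : EReal) - ((N : ENNReal) : EReal) = ⊤ := EReal.top_sub_coe N
    rw [this]; simp
  · have hg : Integrable (fun x => f x * Real.log (f x)) ν := by
      refine ⟨hgm, ?_⟩
      rw [hasFiniteIntegral_iff_norm]
      have : ∀ x, ENNReal.ofReal ‖f x * Real.log (f x)‖ ≤ ENNReal.ofReal (f x * Real.log (f x))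
          + ENNReal.ofReal (-(f x * Real.log (f x))) := by
        intro x
        rw [Real.norm_eq_abs]
        rcases abs_cases (f x * Real.log (f x)) with h | h <;> rw [h.1]
        · exact le_self_add
        · exact le_add_self
      refine (lintegral_mono this).trans_lt ?_
      rw [lintegral_add_left' hgm.aemeasurable.ennreal_ofReal]
      exact ENNReal.add_lt_top.2 ⟨lt_top_iff_ne_top.2 hP, lt_top_iff_ne_top.2 hN⟩
    have hext : extendedIntegral (fun x => f x * Real.log (f x)) ν
        = ((∫ x, f x * Real.log (f x) ∂ν : ℝ) : EReal) := by
      rw [integral_eq_lintegral_pos_part_sub_lintegral_neg_part hg, extendedIntegral]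
      lift ∫⁻ x, ENNReal.ofReal (-(f x * Real.log (f x))) ∂ν to NNReal using hN with N
      lift ∫⁻ x, ENNReal.ofReal (f x * Real.log (f x)) ∂ν to NNReal using hP with Q
      rfl
    rw [hext, ← EReal.coe_neg, EReal.coe_le_coe_iff, ← integral_neg]
    calc ∫ x, -(f x * Real.log (f x)) ∂ν
        ≤ ∫ x, f x * U x + Real.exp (-U x) - f x ∂ν := integral_mono hg.neg hR hpt
      _ = ∫ x, f x * U x ∂ν + ∫ x, Real.exp (-U x) ∂ν - 1 := by
          rw [← hf1, ← integral_add hfU hq]; exact integral_sub (hfU.add hq) hf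
      _ ≤ ∫ x, f x * U x ∂ν := by linarith

/-- The entropy of the field on `A` is at most its cross entropy relative to the centred Gaussian
density with precision matrix `Bᵀ B`. -/
theorem fieldEntropy_le {d : ℕ} {Ω : Type*} [MeasurableSpace Ω] {X : (Fin d → ℤ) → Ω → ℝ}
    {P : Measure Ω} [IsProbabilityMeasure P] {A : Finset (Fin d → ℤ)}
    (hdens : HasPDF (fun ω (i : A) => X i ω) P volume) {B : Matrix A A ℝ} (hB : B.det ≠ 0)
    (hQ : Integrable (fun ω => ∑ i, (B.mulVec fun i : A => X i ω) i ^ 2) P) :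
    fieldEntropy X P A ≤ ((A.card / 2 * Real.log (2 * Real.pi) - Real.log |B.det|
      + (∫ ω, ∑ i, (B.mulVec fun i : A => X i ω) i ^ 2 ∂P) / 2 : ℝ) : EReal) := by
  set c : ℝ := A.card / 2 * Real.log (2 * Real.pi) - Real.log |B.det| with hc
  set U : (A → ℝ) → ℝ := fun x => c + (∑ i, (B.mulVec x) i ^ 2) / 2 with hU
  obtain ⟨h1, h2⟩ := integrable_and_integral_exp_neg_sum_mulVec_sq hB
  rw [Fintype.card_coe] at h2
  have hexp : (fun x => Real.exp (-U x))
      = fun x => Real.exp (-c) * Real.exp (-(∑ i, (B.mulVec x) i ^ 2) / 2) := by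
    ext x
    rw [← Real.exp_add]
    congr 1
    simp only [hU]; ring
  have hUc : Continuous U := by
    simp only [hU]
    fun_prop
  have hUX : Integrable (fun ω => U fun i : A => X i ω) P :=
    (integrable_const c).add (hQ.div_const 2)
  set Y : Ω → A → ℝ := fun ω i => X i ω with hY
  have hint : ∫ x, (pdf Y P volume x).toReal • U x = ∫ ω, U (Y ω) ∂P :=
    pdf.integral_pdf_smul hUc.aestronglyMeasurable
  have hint1 : ∫ x, (pdf Y P volume x).toReal • (1 : ℝ) = ∫ ω, (1 : ℝ) ∂P :=
    pdf.integral_pdf_smul (f := fun _ => (1 : ℝ)) aestronglyMeasurable_const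
  have hi : Integrable (fun x => (pdf Y P volume x).toReal • U x) :=
    (pdf.integrable_pdf_smul_iff hUc.aestronglyMeasurable).2 hUX
  have hi1 : Integrable (fun x => (pdf Y P volume x).toReal • (1 : ℝ)) :=
    (pdf.integrable_pdf_smul_iff (f := fun _ => (1 : ℝ)) aestronglyMeasurable_const).2
      (integrable_const _)
  simp only [smul_eq_mul, mul_one, integral_const, probReal_univ] at hint hint1 hi hi1
  refine (neg_extendedIntegral_mul_log_le (fun x => ENNReal.toReal_nonneg) hi1 hint1 hi ?_
    ?_).trans ?_
  · rw [hexp]; exact h1.const_mul _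
  · rw [hexp, integral_const_mul, h2, ← Real.exp_add, ← hc]; simp
  · rw [hint, EReal.coe_le_coe_iff]
    simp only [hU]
    rw [integral_add (integrable_const c) (hQ.div_const 2), integral_div]
    simp

/-! ### Fourier analysis on the normalized frequency box -/

/-- The uniform probability measure on `[-π, π]ᵈ`. -/
def frequencyMeasure (d : ℕ) : Measure (Fin d → ℝ) :=
  (ENNReal.ofReal ((2 * Real.pi) ^ d))⁻¹ • volume.restrict (frequencyBox d)

theorem volume_frequencyBox (d : ℕ) :
    volume (frequencyBox d) = ENNReal.ofReal ((2 * Real.pi) ^ d) := by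
  have hp := Real.pi_pos
  rw [frequencyBox, Real.volume_Icc_pi, ← ENNReal.ofReal_prod_of_nonneg]
  · congr 1
    rw [show (Real.pi - -Real.pi) = 2 * Real.pi by ring]
    simp
  · intro k _; linarith

instance (d : ℕ) : IsProbabilityMeasure (frequencyMeasure d) := by
  constructor
  have hp := Real.pi_pos
  rw [frequencyMeasure, Measure.smul_apply, Measure.restrict_apply_univ, volume_frequencyBox,
    smul_eq_mul]
  exact ENNReal.inv_mul_cancel (by simp; positivity) ENNReal.ofReal_ne_top

theorem integral_frequencyMeasure {d : ℕ} {E : Type*} [NormedAddCommGroup E] [NormedSpace ℝ E]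
    (f : (Fin d → ℝ) → E) :
    ∫ θ, f θ ∂(frequencyMeasure d) = (1 / (2 * Real.pi) ^ d : ℝ) • ∫ θ in frequencyBox d, f θ := by
  have hp := Real.pi_pos
  rw [frequencyMeasure, integral_smul_measure, ENNReal.toReal_inv,
    ENNReal.toReal_ofReal (by positivity), one_div]

theorem frequencyMeasure_coeff_ne (d : ℕ) :
    (ENNReal.ofReal ((2 * Real.pi) ^ d))⁻¹ ≠ 0 ∧ (ENNReal.ofReal ((2 * Real.pi) ^ d))⁻¹ ≠ ⊤ := by
  have hp := Real.pi_pos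
  refine ⟨ENNReal.inv_ne_zero.2 ENNReal.ofReal_ne_top, ENNReal.inv_ne_top.2 ?_⟩
  simp; positivity

theorem integrable_frequencyMeasure_iff {d : ℕ} {E : Type*} [NormedAddCommGroup E]
    {f : (Fin d → ℝ) → E} :
    Integrable f (frequencyMeasure d) ↔ IntegrableOn f (frequencyBox d) :=
  integrable_smul_measure (frequencyMeasure_coeff_ne d).1 (frequencyMeasure_coeff_ne d).2

theorem ae_frequencyMeasure_iff {d : ℕ} {p : (Fin d → ℝ) → Prop} :
    (∀ᵐ θ ∂(frequencyMeasure d), p θ) ↔ ∀ᵐ θ ∂(volume.restrict (frequencyBox d)), p θ := by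
  rw [frequencyMeasure, Measure.ae_ennreal_smul_measure_iff (frequencyMeasure_coeff_ne d).1]

theorem Continuous.integrable_frequencyMeasure {d : ℕ} {E : Type*} [NormedAddCommGroup E]
    {f : (Fin d → ℝ) → E} (hf : Continuous f) :
    Integrable f (frequencyMeasure d) :=
  integrable_frequencyMeasure_iff.2 (hf.continuousOn.integrableOn_compact isCompact_Icc)

/-- The phase `m · θ`. -/
def phase {d : ℕ} (m : Fin d → ℤ) (θ : Fin d → ℝ) : ℝ := ∑ k, (m k : ℝ) * θ k

@[fun_prop]
theorem continuous_phase {d : ℕ} (m : Fin d → ℤ) : Continuous (phase m) := by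
  unfold phase; fun_prop

theorem phase_sub {d : ℕ} (m n : Fin d → ℤ) (θ : Fin d → ℝ) :
    phase (m - n) θ = phase m θ - phase n θ := by
  simp [phase, sub_mul]

theorem phase_add {d : ℕ} (m n : Fin d → ℤ) (θ : Fin d → ℝ) :
    phase (m + n) θ = phase m θ + phase n θ := by
  simp [phase, add_mul, Finset.sum_add_distrib]

theorem phase_neg {d : ℕ} (m : Fin d → ℤ) (θ : Fin d → ℝ) : phase (-m) θ = -phase m θ := by
  simp [phase]

theorem integral_exp_phase {d : ℕ} (m : Fin d → ℤ) :
    ∫ θ, Complex.exp (Complex.I * phase m θ) ∂(frequencyMeasure d) = if m = 0 then 1 else 0 := by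
  have h := integral_box_exp m
  have hp := Real.pi_pos
  rw [integral_frequencyMeasure]
  simp only [phase, Complex.ofReal_sum, Complex.ofReal_mul, Complex.ofReal_intCast]
  rw [h, Complex.real_smul]
  split_ifs
  · push_cast
    have : (2 * (Real.pi : ℂ)) ^ d ≠ 0 := pow_ne_zero _ (by simp [Real.pi_ne_zero])
    field_simp
  · simp

theorem integral_cos_phase {d : ℕ} (m : Fin d → ℤ) :
    ∫ θ, Real.cos (phase m θ) ∂(frequencyMeasure d) = if m = 0 then 1 else 0 := by
  have h := congrArg Complex.re (integral_exp_phase m)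
  have hint : Integrable (fun θ => Complex.exp (Complex.I * phase m θ)) (frequencyMeasure d) :=
    Continuous.integrable_frequencyMeasure (by fun_prop)
  have h2 := integral_re hint
  simp only [RCLike.re_to_complex] at h2
  rw [← h2] at h
  have h3 : ∀ θ, (Complex.exp (Complex.I * phase m θ)).re = Real.cos (phase m θ) := fun θ => by
    rw [mul_comm, Complex.exp_ofReal_mul_I_re]
  simp only [h3] at h
  rw [h]; split_ifs <;> simp

/-! ### Toeplitz matrices of a positive symbol -/

/-- The Toeplitz matrix on the sites `A` of the symbol `w`. -/
def toeplitz {d : ℕ} (A : Finset (Fin d → ℤ)) (w : (Fin d → ℝ) → ℝ) : Matrix A A ℝ :=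
  Matrix.of fun i j => ∫ θ, w θ * Real.cos (phase (i - j : Fin d → ℤ) θ) ∂(frequencyMeasure d)

/-- The squared modulus of the Fourier transform `∑ x_i e^{i·θ}` of `x`. -/
def periodogram {d : ℕ} {A : Finset (Fin d → ℤ)} (x : A → ℝ) (θ : Fin d → ℝ) : ℝ :=
  (∑ i, x i * Real.cos (phase (i : Fin d → ℤ) θ)) ^ 2
    + (∑ i, x i * Real.sin (phase (i : Fin d → ℤ) θ)) ^ 2

theorem periodogram_nonneg {d : ℕ} {A : Finset (Fin d → ℤ)} (x : A → ℝ) (θ : Fin d → ℝ) :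
    0 ≤ periodogram x θ := by
  unfold periodogram; positivity

@[fun_prop]
theorem continuous_periodogram {d : ℕ} {A : Finset (Fin d → ℤ)} (x : A → ℝ) :
    Continuous (periodogram x) := by
  unfold periodogram; fun_prop

theorem periodogram_eq {d : ℕ} {A : Finset (Fin d → ℤ)} (x : A → ℝ) (θ : Fin d → ℝ) :
    periodogram x θ = ∑ i, ∑ j, x i * x j * Real.cos (phase (i - j : Fin d → ℤ) θ) := by
  simp only [periodogram, phase_sub, Real.cos_sub, sq, Finset.sum_mul_sum,
    ← Finset.sum_add_distrib]
  refine Finset.sum_congr rfl fun i _ => Finset.sum_congr rfl fun j _ => ?_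
  ring

/-- The quadratic form of a Toeplitz matrix is the integral of its symbol against the periodogram. -/
theorem dotProduct_toeplitz_mulVec {d : ℕ} {A : Finset (Fin d → ℤ)} {w : (Fin d → ℝ) → ℝ}
    (hw : Continuous w) (x : A → ℝ) :
    x ⬝ᵥ (toeplitz A w).mulVec x = ∫ θ, w θ * periodogram x θ ∂(frequencyMeasure d) := by
  have hc : ∀ i j : A, Integrable (fun θ =>
      x i * x j * (w θ * Real.cos (phase (i - j : Fin d → ℤ) θ))) (frequencyMeasure d) :=
    fun i j => Continuous.integrable_frequencyMeasure (by fun_prop)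
  have h1 : ∀ θ, w θ * periodogram x θ
      = ∑ i, ∑ j, x i * x j * (w θ * Real.cos (phase (i - j : Fin d → ℤ) θ)) := by
    intro θ
    rw [periodogram_eq, Finset.mul_sum]
    refine Finset.sum_congr rfl fun i _ => ?_
    rw [Finset.mul_sum]
    refine Finset.sum_congr rfl fun j _ => ?_
    ring
  simp only [h1]
  rw [integral_finsetSum _ fun i _ => integrable_finsetSum _ fun j _ => hc i j]
  simp only [dotProduct, Matrix.mulVec, toeplitz, Matrix.of_apply, Finset.mul_sum]
  refine Finset.sum_congr rfl fun i _ => ?_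
  rw [integral_finsetSum _ fun j _ => hc i j]
  refine Finset.sum_congr rfl fun j _ => ?_
  rw [integral_const_mul]; ring

theorem integral_periodogram {d : ℕ} {A : Finset (Fin d → ℤ)} (x : A → ℝ) :
    ∫ θ, periodogram x θ ∂(frequencyMeasure d) = ∑ i, x i ^ 2 := by
  have h := dotProduct_toeplitz_mulVec (w := fun _ => 1) continuous_const x
  simp only [one_mul] at h
  rw [← h]
  have h1 : toeplitz A (fun _ => 1) = (1 : Matrix A A ℝ) := by
    ext i j
    simp only [toeplitz, Matrix.of_apply, one_mul, integral_cos_phase, Matrix.one_apply,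
      sub_eq_zero, Subtype.ext_iff]
  rw [h1, Matrix.one_mulVec]
  simp [dotProduct, sq]

theorem toeplitz_isHermitian {d : ℕ} (A : Finset (Fin d → ℤ)) (w : (Fin d → ℝ) → ℝ) :
    (toeplitz A w).IsHermitian := by
  refine Matrix.IsHermitian.ext fun i j => ?_
  simp only [toeplitz, Matrix.of_apply, star_trivial]
  congr 1
  ext θ
  rw [← neg_sub, phase_neg, Real.cos_neg]

theorem toeplitz_posDef {d : ℕ} (A : Finset (Fin d → ℤ)) {w : (Fin d → ℝ) → ℝ}
    (hw : Continuous w) {δ : ℝ} (hδ : 0 < δ) (hwδ : ∀ θ, δ ≤ w θ) : (toeplitz A w).PosDef := by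
  refine Matrix.PosDef.of_dotProduct_mulVec_pos (toeplitz_isHermitian A w) fun x hx => ?_
  rw [star_trivial, dotProduct_toeplitz_mulVec hw]
  have h1 : 0 < ∑ i, x i ^ 2 := by
    obtain ⟨i, hi⟩ := Function.ne_iff.1 hx
    exact Finset.sum_pos' (fun j _ => sq_nonneg _) ⟨i, Finset.mem_univ _, by
      have : x i ≠ 0 := hi
      positivity⟩
  calc 0 < δ * ∑ i, x i ^ 2 := by positivity
    _ = ∫ θ, δ * periodogram x θ ∂(frequencyMeasure d) := by
        rw [integral_const_mul, integral_periodogram]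
    _ ≤ ∫ θ, w θ * periodogram x θ ∂(frequencyMeasure d) := integral_mono (Continuous.integrable_frequencyMeasure (by fun_prop))
        (Continuous.integrable_frequencyMeasure (by fun_prop))
        fun θ => mul_le_mul_of_nonneg_right (hwδ θ) (periodogram_nonneg x θ)

/-- The Toeplitz determinant of a positive symbol `w` is at least `exp (|A| ∫ log w)`, on any finite
set `A` of sites. By Jensen's inequality for the probability measure with density the periodogram
of a normalized eigenvector, the logarithm of the eigenvalue is at least the mean of `log w`; by
Parseval's identity the periodograms of an orthonormal eigenbasis sum to `|A|`. -/
theorem card_mul_integral_log_le_log_det_toeplitz {d : ℕ} (A : Finset (Fin d → ℤ))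
    {w : (Fin d → ℝ) → ℝ} (hw : Continuous w) {δ : ℝ} (hδ : 0 < δ) (hwδ : ∀ θ, δ ≤ w θ) :
    A.card * ∫ θ, Real.log (w θ) ∂(frequencyMeasure d) ≤ Real.log (toeplitz A w).det := by
  have hpos := toeplitz_posDef A hw hδ hwδ
  set hM := toeplitz_isHermitian A w
  have hw0 : ∀ θ, 0 < w θ := fun θ => hδ.trans_le (hwδ θ)
  have hlog : Continuous fun θ => Real.log (w θ) := hw.log fun θ => (hw0 θ).ne'
  have hev : ∀ k, 0 < hM.eigenvalues k := hpos.eigenvalues_pos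
  set v : A → A → ℝ := fun k => hM.eigenvectorBasis k with hv
  have hv1 : ∀ k, ∑ i, v k i ^ 2 = 1 := by
    intro k
    have := hM.eigenvectorBasis.orthonormal.1 k
    rw [EuclideanSpace.norm_eq, Real.sqrt_eq_one] at this
    simpa using this
  have hquad : ∀ k, ∫ θ, w θ * periodogram (v k) θ ∂(frequencyMeasure d) = hM.eigenvalues k := by
    intro k
    rw [← dotProduct_toeplitz_mulVec hw, hM.mulVec_eigenvectorBasis k, dotProduct_smul]
    have : v k ⬝ᵥ v k = 1 := by
      rw [← hv1 k]; simp [dotProduct, sq]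
    rw [smul_eq_mul]
    exact (congrArg _ this).trans (mul_one _)
  -- Parseval in the eigenbasis
  have hparseval : ∀ y : A → ℝ, ∑ k, (∑ i, v k i * y i) ^ 2 = ∑ i, y i ^ 2 := by
    intro y
    have := hM.eigenvectorBasis.sum_sq_inner_right (WithLp.toLp 2 y)
    rw [EuclideanSpace.norm_sq_eq] at this
    simpa [PiLp.inner_apply, hv, mul_comm] using this
  have hsum : ∀ θ, ∑ k, periodogram (v k) θ = A.card := by
    intro θ
    simp only [periodogram, Finset.sum_add_distrib]
    rw [hparseval, hparseval, ← Finset.sum_add_distrib]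
    simp
  have hk : ∀ k, ∫ θ, Real.log (w θ) * periodogram (v k) θ ∂(frequencyMeasure d)
      ≤ Real.log (hM.eigenvalues k) := by
    intro k
    set l := hM.eigenvalues k with hl
    -- Jensen's inequality for `log`, through its tangent line at the eigenvalue
    have hl0 : 0 < l := hev k
    have hpt : ∀ θ, Real.log (w θ) * periodogram (v k) θ
        ≤ (Real.log l - 1) * periodogram (v k) θ + l⁻¹ * (w θ * periodogram (v k) θ) := by
      intro θ
      have h1 := Real.log_le_sub_one_of_pos (div_pos (hw0 θ) hl0)
      rw [Real.log_div (hw0 θ).ne' hl0.ne'] at h1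
      have h2 : Real.log (w θ) ≤ (Real.log l - 1) + l⁻¹ * w θ := by
        rw [inv_mul_eq_div]; linarith
      calc _ ≤ ((Real.log l - 1) + l⁻¹ * w θ) * periodogram (v k) θ :=
            mul_le_mul_of_nonneg_right h2 (periodogram_nonneg _ _)
        _ = _ := by ring
    have hi1 : Integrable (fun θ => (Real.log l - 1) * periodogram (v k) θ) (frequencyMeasure d) :=
      Continuous.integrable_frequencyMeasure (by fun_prop)
    have hi2 : Integrable (fun θ => l⁻¹ * (w θ * periodogram (v k) θ)) (frequencyMeasure d) :=
      Continuous.integrable_frequencyMeasure (by fun_prop)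
    have := integral_mono (Continuous.integrable_frequencyMeasure (by fun_prop)) (hi1.add hi2) hpt
    refine this.trans (le_of_eq ?_)
    simp only [Pi.add_apply]
    rw [integral_add hi1 hi2, integral_const_mul, integral_const_mul, hquad, integral_periodogram,
      hv1, ← hl, inv_mul_cancel₀ hl0.ne']
    ring
  calc A.card * ∫ θ, Real.log (w θ) ∂(frequencyMeasure d)
      = ∫ θ, ∑ k, Real.log (w θ) * periodogram (v k) θ ∂(frequencyMeasure d) := by
        rw [← integral_const_mul]
        simp only [← Finset.mul_sum, hsum, mul_comm]
    _ = ∑ k, ∫ θ, Real.log (w θ) * periodogram (v k) θ ∂(frequencyMeasure d) :=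
        integral_finsetSum _ fun k _ => Continuous.integrable_frequencyMeasure (by fun_prop)
    _ ≤ ∑ k, Real.log (hM.eigenvalues k) := Finset.sum_le_sum fun k _ => hk k
    _ = Real.log (toeplitz A w).det := by
        rw [hM.det_eq_prod_eigenvalues]
        simp only [RCLike.ofReal_real_eq_id, id]
        rw [Real.log_prod fun k _ => (hev k).ne']

/-! ### Trigonometric polynomials and traces -/

/-- The quotient map from frequencies `θ ∈ ℝᵈ` to the torus `(ℝ / ℤ)ᵈ`, `θ ↦ θ / 2π`. -/
def toTorus {d : ℕ} (θ : Fin d → ℝ) : UnitAddTorus (Fin d) :=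
  fun k => ((θ k / (2 * Real.pi) : ℝ) : UnitAddCircle)

@[fun_prop]
theorem continuous_toTorus {d : ℕ} : Continuous (toTorus (d := d)) := by
  refine continuous_pi fun k => ?_
  exact (AddCircle.continuous_mk' 1).comp (by fun_prop)

theorem mFourier_toTorus {d : ℕ} (m : Fin d → ℤ) (θ : Fin d → ℝ) :
    UnitAddTorus.mFourier m (toTorus θ) = Complex.exp (Complex.I * phase m θ) := by
  simp only [UnitAddTorus.mFourier, toTorus, ContinuousMap.coe_mk, fourier_coe_apply, phase]
  rw [← Complex.exp_sum]
  congr 1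
  push_cast
  rw [Finset.mul_sum]
  refine Finset.sum_congr rfl fun k _ => ?_
  have : (Real.pi : ℂ) ≠ 0 := by simp [Real.pi_ne_zero]
  field_simp

theorem integral_exp_phase_mul_cos_phase {d : ℕ} (m n : Fin d → ℤ) :
    ∫ θ, Complex.exp (Complex.I * phase m θ) * (Real.cos (phase n θ) : ℂ) ∂(frequencyMeasure d)
      = ((if m + n = 0 then 1 else 0) + (if m - n = 0 then 1 else 0)) / 2 := by
  have h : ∀ θ, Complex.exp (Complex.I * phase m θ) * (Real.cos (phase n θ) : ℂ)
      = (Complex.exp (Complex.I * phase (m + n) θ)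
        + Complex.exp (Complex.I * phase (m - n) θ)) / 2 := by
    intro θ
    rw [phase_add, phase_sub, Complex.ofReal_cos, Complex.cos]
    push_cast
    rw [mul_add, mul_sub, Complex.exp_add, sub_eq_add_neg, Complex.exp_add]
    ring_nf
  simp only [h]
  rw [integral_div, integral_add, integral_exp_phase, integral_exp_phase] <;>
  exact Continuous.integrable_frequencyMeasure (by fun_prop)

theorem IsStructureFunction.integral_exp_phase_mul {d : ℕ} {S : (Fin d → ℝ) → ℝ}
    {K : (Fin d → ℤ) → ℝ} (hS : IsStructureFunction S K) (m : Fin d → ℤ) :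
    ∫ θ, Complex.exp (Complex.I * phase m θ) * (S θ : ℂ) ∂(frequencyMeasure d) = K (-m) := by
  rw [← hS.fourierCoeff_eq (-m), integral_frequencyMeasure, Complex.real_smul]
  congr 1
  · push_cast; rfl
  · congr 1
    ext θ
    congr 2
    simp only [phase, Pi.neg_apply]
    push_cast
    simp [Finset.sum_neg_distrib]

/-- The sum of `K (i - j)` over the pairs of sites of `A` with difference `m`. -/
theorem sum_sum_mul_ite_sub_eq {d : ℕ} (A : Finset (Fin d → ℤ)) (K : (Fin d → ℤ) → ℂ)
    (m : Fin d → ℤ) :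
    ∑ i ∈ A, ∑ j ∈ A, K (i - j) * (if m - (i - j) = 0 then 1 else 0)
      = K m * (A.filter fun i => i - m ∈ A).card := by
  have h : ∀ i, ∑ j ∈ A, K (i - j) * (if m - (i - j) = 0 then 1 else 0)
      = if i - m ∈ A then K m else 0 := by
    intro i
    rw [← Finset.sum_ite_eq A (i - m) fun _ => K m]
    refine Finset.sum_congr rfl fun j _ => ?_
    have : m - (i - j) = 0 ↔ i - m = j := by
      rw [sub_eq_zero, eq_sub_iff_add_eq, sub_eq_iff_eq_add, eq_comm, add_comm m j]
    by_cases hj : i - m = j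
    · rw [if_pos (this.2 hj), if_pos hj, mul_one, sub_eq_zero.1 (this.2 hj)]
    · rw [if_neg fun h => hj (this.1 h), if_neg hj, mul_zero]
  simp only [h]
  rw [← Finset.sum_filter, Finset.sum_const, nsmul_eq_mul, mul_comm]

/-- Along a Følner family, the trace of the product of the covariance matrix with the symmetrized
Toeplitz matrix of a trigonometric polynomial `G` is asymptotically `|A| ∫ G S`. By linearity it
suffices to take `G` an exponential `exp (i m·θ)`, for which only pairs of sites with difference
`±m` contribute. -/
theorem IsStructureFunction.tendsto_trace_div_card {d : ℕ} {S : (Fin d → ℝ) → ℝ}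
    {K : (Fin d → ℤ) → ℝ} (hS : IsStructureFunction S K) (hK : ∀ m, K (-m) = K m)
    {ι : Type*} {l : Filter ι} {A : ι → Finset (Fin d → ℤ)}
    (hA : ∀ m : Fin d → ℤ, Tendsto
      (fun t => (((A t).filter fun i => i - m ∈ A t).card : ℝ) / (A t).card) l (𝓝 1))
    {G : C(UnitAddTorus (Fin d), ℂ)}
    (hG : G ∈ Submodule.span ℂ (Set.range (UnitAddTorus.mFourier (d := Fin d)))) :
    Tendsto (fun t => (∑ i ∈ A t, ∑ j ∈ A t, (K (i - j) : ℂ) *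
        ∫ θ, G (toTorus θ) * (Real.cos (phase (i - j) θ) : ℂ) ∂(frequencyMeasure d)) / (A t).card) l
      (𝓝 (∫ θ, G (toTorus θ) * (S θ : ℂ) ∂(frequencyMeasure d))) := by
  have hSi : Integrable (fun θ => (S θ : ℂ)) (frequencyMeasure d) :=
    (integrable_frequencyMeasure_iff.2 hS.integrableOn).ofReal
  have hGS : ∀ G : C(UnitAddTorus (Fin d), ℂ),
      Integrable (fun θ => G (toTorus θ) * (S θ : ℂ)) (frequencyMeasure d) := fun G =>
    hSi.bdd_mul (c := ‖G‖) (by fun_prop : Continuous _).aestronglyMeasurable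
      (Eventually.of_forall fun θ => G.norm_coe_le_norm _)
  have hGc : ∀ (G : C(UnitAddTorus (Fin d), ℂ)) (n : Fin d → ℤ), Integrable
      (fun θ => G (toTorus θ) * (Real.cos (phase n θ) : ℂ)) (frequencyMeasure d) := fun G n =>
    Continuous.integrable_frequencyMeasure (by fun_prop)
  induction hG using Submodule.span_induction with
  | mem G hG =>
    obtain ⟨m, rfl⟩ := hG
    simp only [mFourier_toTorus, integral_exp_phase_mul_cos_phase, hS.integral_exp_phase_mul, hK]
    have hsum : ∀ t, (∑ i ∈ A t, ∑ j ∈ A t, (K (i - j) : ℂ) *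
        (((if m + (i - j) = 0 then 1 else 0) + (if m - (i - j) = 0 then 1 else 0)) / 2))
        / (A t).card = (K m / 2 : ℂ) *
          (((((A t).filter fun i => i - -m ∈ A t).card : ℝ) / (A t).card : ℝ)
          + ((((A t).filter fun i => i - m ∈ A t).card : ℝ) / (A t).card : ℝ)) := by
      intro t
      have h1 := sum_sum_mul_ite_sub_eq (A t) (fun i => (K i : ℂ)) m
      have h2 := sum_sum_mul_ite_sub_eq (A t) (fun i => (K i : ℂ)) (-m)
      have e : ∀ i j : Fin d → ℤ, -m - (i - j) = 0 ↔ m + (i - j) = 0 := fun i j => by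
        rw [← neg_add', neg_eq_zero]
      simp only [e, hK] at h2
      have : ∀ i j : Fin d → ℤ, (K (i - j) : ℂ) *
          (((if m + (i - j) = 0 then 1 else 0) + (if m - (i - j) = 0 then 1 else 0)) / 2)
          = (K (i - j) * (if m + (i - j) = 0 then 1 else 0)) * (1 / 2)
            + (K (i - j) * (if m - (i - j) = 0 then 1 else 0)) * (1 / 2) := by
        intro i j; ring
      simp only [this, Finset.sum_add_distrib, ← Finset.sum_mul, h1, h2]
      push_cast
      ring
    simp only [hsum]
    have h1 := (Complex.continuous_ofReal.tendsto _).comp (hA (-m))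
    have h2 := (Complex.continuous_ofReal.tendsto _).comp (hA m)
    have := (h1.add h2).const_mul (K m / 2 : ℂ)
    rw [show (K m / 2 : ℂ) * (((1 : ℝ) : ℂ) + ((1 : ℝ) : ℂ)) = K m by push_cast; ring] at this
    exact this
  | zero => simpa using tendsto_const_nhds
  | add G H _ _ hG hH =>
    simp only [ContinuousMap.add_apply, add_mul]
    rw [integral_add (hGS G) (hGS H)]
    refine (hG.add hH).congr fun t => ?_
    simp only [integral_add (hGc G _) (hGc H _), mul_add, Finset.sum_add_distrib, add_div]
  | smul a G _ hG =>
    simp only [ContinuousMap.smul_apply, smul_eq_mul, mul_assoc]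
    rw [integral_const_mul]
    refine (hG.const_mul a).congr fun t => ?_
    simp only [integral_const_mul, mul_left_comm _ a, ← Finset.mul_sum, mul_div_assoc]

theorem IsStructureFunction.tendsto_toeplitz_trace_div_card {d : ℕ} {S : (Fin d → ℝ) → ℝ}
    {K : (Fin d → ℤ) → ℝ} (hS : IsStructureFunction S K) (hK : ∀ m, K (-m) = K m)
    {ι : Type*} {l : Filter ι} {A : ι → Finset (Fin d → ℤ)}
    (hA : ∀ m : Fin d → ℤ, Tendsto
      (fun t => (((A t).filter fun i => i - m ∈ A t).card : ℝ) / (A t).card) l (𝓝 1))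
    {G : C(UnitAddTorus (Fin d), ℂ)}
    (hG : G ∈ Submodule.span ℂ (Set.range (UnitAddTorus.mFourier (d := Fin d)))) :
    Tendsto (fun t => (∑ i : A t, ∑ j : A t, K (i - j) *
        toeplitz (A t) (fun θ => (G (toTorus θ)).re) i j) / (A t).card) l
      (𝓝 (∫ θ, S θ * (G (toTorus θ)).re ∂(frequencyMeasure d))) := by
  have h := (Complex.continuous_re.tendsto _).comp (hS.tendsto_trace_div_card hK hA hG)
  have hSi : Integrable (fun θ => (S θ : ℂ)) (frequencyMeasure d) :=
    (integrable_frequencyMeasure_iff.2 hS.integrableOn).ofReal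
  have hGS : Integrable (fun θ => G (toTorus θ) * (S θ : ℂ)) (frequencyMeasure d) :=
    hSi.bdd_mul (c := ‖G‖) (by fun_prop : Continuous _).aestronglyMeasurable
      (Eventually.of_forall fun θ => G.norm_coe_le_norm _)
  have hGc : ∀ (n : Fin d → ℤ), Integrable
      (fun θ => G (toTorus θ) * (Real.cos (phase n θ) : ℂ)) (frequencyMeasure d) := fun n =>
    Continuous.integrable_frequencyMeasure (by fun_prop)
  have e1 : (∫ θ, G (toTorus θ) * (S θ : ℂ) ∂(frequencyMeasure d)).re
      = ∫ θ, S θ * (G (toTorus θ)).re ∂(frequencyMeasure d) := by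
    have := integral_re hGS
    simp only [RCLike.re_to_complex, Complex.re_mul_ofReal] at this
    rw [← this]; simp only [mul_comm]
  have e2 : ∀ n, (∫ θ, G (toTorus θ) * (Real.cos (phase n θ) : ℂ) ∂(frequencyMeasure d)).re
      = ∫ θ, (G (toTorus θ)).re * Real.cos (phase n θ) ∂(frequencyMeasure d) := by
    intro n
    have := integral_re (hGc n)
    simp only [RCLike.re_to_complex, Complex.re_mul_ofReal] at this
    exact this.symm
  rw [e1] at h
  refine h.congr fun t => ?_
  simp only [Function.comp, Complex.div_natCast_re, Complex.re_sum, Complex.re_ofReal_mul, e2,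
    toeplitz, Matrix.of_apply]
  congr 1
  rw [← Finset.sum_coe_sort (A t)]
  refine Finset.sum_congr rfl fun i _ => ?_
  rw [← Finset.sum_coe_sort (A t)]

/-! ### Trigonometric polynomials that make the entropy bound small -/

theorem integrable_log_max_add {d : ℕ} {S : (Fin d → ℝ) → ℝ}
    (hS : Integrable S (frequencyMeasure d)) {ε : ℝ} (hε : 0 < ε) (hε1 : ε ≤ 1) :
    Integrable (fun θ => Real.log (max (S θ) 0 + ε)) (frequencyMeasure d) := by
  refine (hS.abs.add (integrable_const |Real.log ε|)).mono'
    (((hS.aemeasurable.max aemeasurable_const).add_const ε).log).aestronglyMeasurable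
    (Eventually.of_forall fun θ => ?_)
  have h0 : 0 ≤ max (S θ) 0 := le_max_right _ _
  have h1 : max (S θ) 0 ≤ |S θ| := max_le (le_abs_self _) (abs_nonneg _)
  have h2 : Real.log ε ≤ Real.log (max (S θ) 0 + ε) := Real.log_le_log hε (by linarith)
  have h3 := Real.log_le_sub_one_of_pos (by linarith : 0 < max (S θ) 0 + ε)
  have h4 := neg_abs_le (Real.log ε)
  have h5 := abs_nonneg (Real.log ε)
  have h6 := abs_nonneg (S θ)
  rw [Real.norm_eq_abs, abs_le, Pi.add_apply]
  constructor <;> linarith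

/-- If `∫ log (S⁺ + ε)` is bounded below as `ε → 0`, then `log S` is integrable, by Fatou's lemma for
`log (S⁺ + 1) - log (S⁺ + ε)`, which tends to `∞` where `S ≤ 0`. -/
theorem isLogIntegrable_of_forall_lt_integral {d : ℕ} {S : (Fin d → ℝ) → ℝ}
    (hS : Integrable S (frequencyMeasure d)) {C : ℝ} (hC : ∀ ε : ℝ, 0 < ε → ε ≤ 1 →
      C ≤ ∫ θ, Real.log (max (S θ) 0 + ε) ∂(frequencyMeasure d)) : IsLogIntegrable S := by
  set ε : ℕ → ℝ := fun k => 1 / ((k : ℝ) + 1) with hεdef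
  have hε : ∀ k, 0 < ε k := fun k => by positivity
  have hε1 : ∀ k, ε k ≤ 1 := fun k => by
    simp only [hεdef]; rw [div_le_one (by positivity)]; linarith [k.cast_nonneg (α := ℝ)]
  have hε0 : Tendsto ε atTop (𝓝 0) := tendsto_one_div_add_atTop_nhds_zero_nat
  have hi1 := integrable_log_max_add hS one_pos le_rfl
  have hi : ∀ k, Integrable (fun θ =>
      Real.log (max (S θ) 0 + 1) - Real.log (max (S θ) 0 + ε k)) (frequencyMeasure d) :=
    fun k => hi1.sub (integrable_log_max_add hS (hε k) (hε1 k))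
  set D : ℝ := ∫ θ, Real.log (max (S θ) 0 + 1) ∂(frequencyMeasure d) - C with hD
  have hbound : ∀ k, ∫⁻ θ, ENNReal.ofReal
      (Real.log (max (S θ) 0 + 1) - Real.log (max (S θ) 0 + ε k)) ∂(frequencyMeasure d)
      ≤ ENNReal.ofReal D := by
    intro k
    rw [← ofReal_integral_eq_lintegral_ofReal (hi k)]
    · refine ENNReal.ofReal_le_ofReal ?_
      rw [integral_sub hi1 (integrable_log_max_add hS (hε k) (hε1 k))]
      linarith [hC (ε k) (hε k) (hε1 k)]
    · refine Eventually.of_forall fun θ => ?_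
      have h0 : 0 ≤ max (S θ) 0 := le_max_right _ _
      exact sub_nonneg.2 (Real.log_le_log (by linarith [hε k]) (by linarith [hε1 k]))
  have hF := (lintegral_liminf_le' (u := atTop) fun k => (hi k).aemeasurable.ennreal_ofReal).trans
    (liminf_le_of_frequently_le' (Frequently.of_forall hbound))
  have hFm : AEMeasurable (fun θ => liminf (fun k => ENNReal.ofReal
      (Real.log (max (S θ) 0 + 1) - Real.log (max (S θ) 0 + ε k))) atTop) (frequencyMeasure d) := by
    have hm := fun k => (hi k).aemeasurable.ennreal_ofReal
    refine ⟨fun θ => liminf (fun k => (hm k).mk _ θ) atTop,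
      Measurable.liminf fun k => (hm k).measurable_mk, ?_⟩
    filter_upwards [ae_all_iff.2 fun k => (hm k).ae_eq_mk] with θ hθ
    exact congrArg (fun u => liminf u atTop) (funext hθ)
  have hlt := ae_lt_top' hFm (hF.trans_lt ENNReal.ofReal_lt_top).ne
  have hpos : ∀ᵐ θ ∂(frequencyMeasure d), 0 < S θ := by
    filter_upwards [hlt] with θ hθ
    by_contra! hneg
    have h1 : Tendsto (fun k => -Real.log (ε k)) atTop atTop :=
      tendsto_neg_atBot_atTop.comp (Real.tendsto_log_nhdsGT_zero.comp
        (tendsto_nhdsWithin_iff.2 ⟨hε0, Eventually.of_forall hε⟩))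
    have h2 := (ENNReal.tendsto_ofReal_atTop.comp h1).liminf_eq
    simp only [max_eq_right hneg, zero_add, Real.log_one, zero_sub] at hθ
    exact hθ.ne h2
  have hlim : ∀ᵐ θ ∂(frequencyMeasure d), liminf (fun k => ENNReal.ofReal
      (Real.log (max (S θ) 0 + 1) - Real.log (max (S θ) 0 + ε k))) atTop
      = ENNReal.ofReal (Real.log (max (S θ) 0 + 1) - Real.log (S θ)) := by
    filter_upwards [hpos] with θ hθ
    refine Tendsto.liminf_eq (ENNReal.tendsto_ofReal (tendsto_const_nhds.sub ?_))
    rw [max_eq_left hθ.le]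
    have := (hε0.const_add (S θ)).log (by simpa using hθ.ne')
    simpa using this
  rw [lintegral_congr_ae hlim] at hF
  have hint : Integrable (fun θ => Real.log (max (S θ) 0 + 1) - Real.log (S θ))
      (frequencyMeasure d) := by
    refine ⟨(hi1.aemeasurable.sub hS.aemeasurable.log).aestronglyMeasurable, ?_⟩
    rw [hasFiniteIntegral_iff_ofReal]
    · exact hF.trans_lt ENNReal.ofReal_lt_top
    · filter_upwards [hpos] with θ hθ
      rw [max_eq_left hθ.le]
      exact sub_nonneg.2 (Real.log_le_log hθ (by linarith))
  refine ⟨ae_frequencyMeasure_iff.1 hpos, integrable_frequencyMeasure_iff.1 ?_⟩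
  have := hi1.sub hint
  refine this.congr (Eventually.of_forall fun θ => ?_)
  simp

/-- Bounded measurable functions of the frequency are approximated by continuous functions on the
torus (that is, by continuous periodic functions) in weighted `L¹`. -/
theorem exists_continuousMap_integral_le {d : ℕ} {ρ : (Fin d → ℝ) → ℝ}
    (hρ : Integrable ρ (frequencyMeasure d)) (hρ0 : ∀ θ, 0 ≤ ρ θ) {W : (Fin d → ℝ) → ℝ}
    (hW : Measurable W) {b : ℝ} (hWb : ∀ θ, |W θ| ≤ b) {η : ℝ} (hη : 0 < η) :
    ∃ g : C(UnitAddTorus (Fin d), ℝ),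
      ∫ θ, ρ θ * |W θ - g (toTorus θ)| ∂(frequencyMeasure d) ≤ η := by
  have hp := Real.pi_pos
  -- a measurable section of `toTorus`, with values in `(-π, π]ᵈ`
  set s : UnitAddTorus (Fin d) → Fin d → ℝ := fun x k =>
    2 * Real.pi * (UnitAddTorus.measurableEquivPiIoc (fun _ : Fin d => -(1 / 2 : ℝ)) x).1 k with hs
  have hsm : Measurable s := by
    refine measurable_pi_lambda _ fun k => Measurable.const_mul ?_ _
    exact (measurable_pi_apply k).comp (measurable_subtype_coe.comp
      (UnitAddTorus.measurableEquivPiIoc (fun _ : Fin d => -(1 / 2 : ℝ))).measurable)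
  have hsec : ∀ᵐ θ ∂(frequencyMeasure d), s (toTorus θ) = θ := by
    rw [ae_frequencyMeasure_iff, frequencyBox, volume_pi,
      ← Measure.restrict_congr_set (Measure.univ_pi_Ioc_ae_eq_Icc (μ := fun _ : Fin d => volume))]
    filter_upwards [ae_restrict_mem (MeasurableSet.univ_pi fun k => measurableSet_Ioc)] with θ hθ
    ext k
    have hk := hθ k (Set.mem_univ k)
    have hk' : θ k / (2 * Real.pi) ∈ Set.Ioc (-(1 / 2 : ℝ)) (-(1 / 2) + 1) := by
      constructor
      · rw [lt_div_iff₀ (by positivity)]; linarith [hk.1]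
      · rw [div_le_iff₀ (by positivity)]; linarith [hk.2]
    simp only [hs, UnitAddTorus.coe_measurableEquivPiIoc_apply, toTorus]
    rw [AddCircle.equivIoc_coe_of_mem hk']
    field_simp
  set ν := (frequencyMeasure d).withDensity fun θ => ENNReal.ofReal (ρ θ) with hν
  have : IsFiniteMeasure ν := isFiniteMeasure_withDensity_ofReal hρ.2
  have hWs : Measurable (W ∘ s) := hW.comp hsm
  have hWi : Integrable (W ∘ s) (ν.map toTorus) :=
    Integrable.of_bound hWs.aestronglyMeasurable b (Eventually.of_forall fun x => hWb _)
  obtain ⟨g, hg, -⟩ := hWi.exists_boundedContinuous_integral_sub_le hη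
  refine ⟨g.toContinuousMap, ?_⟩
  rw [integral_map continuous_toTorus.measurable.aemeasurable
    (by
      have : Measurable fun x => ‖(W ∘ s) x - g x‖ := (hWs.sub g.continuous.measurable).norm
      exact this.aestronglyMeasurable), hν,
    integral_withDensity_eq_integral_toReal_smul₀ hρ.aemeasurable.ennreal_ofReal
      (Eventually.of_forall fun _ => ENNReal.ofReal_lt_top)] at hg
  refine le_of_eq_of_le (integral_congr_ae ?_) hg
  filter_upwards [hsec] with θ hθ
  simp only [Function.comp, hθ, ENNReal.toReal_ofReal (hρ0 θ), smul_eq_mul, Real.norm_eq_abs]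
  rfl

/-- If `log S` is not integrable, then `∫ S w - ∫ log w` is unbounded below on the trigonometric
polynomials `w ≥ 1/2`. Nonnegativity of `S` is not needed: for `w = 1 + 1 / (S⁺ + ε)` the first
integral is at most `∫ |S| + 1`, and the second one is at least `-∫ log (S⁺ + ε)`. -/
theorem exists_trigPolynomial_integral_le {d : ℕ} {S : (Fin d → ℝ) → ℝ}
    (hS : Integrable S (frequencyMeasure d)) (hlog : ¬ IsLogIntegrable S) (C : ℝ) :
    ∃ G ∈ Submodule.span ℂ (Set.range (UnitAddTorus.mFourier (d := Fin d))),
      (∀ x, 1 / 2 ≤ (G x).re) ∧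
      ∫ θ, S θ * (G (toTorus θ)).re ∂(frequencyMeasure d)
        - ∫ θ, Real.log (G (toTorus θ)).re ∂(frequencyMeasure d) ≤ C := by
  set I : ℝ := ∫ θ, |S θ| ∂(frequencyMeasure d) with hI
  -- `2 I + 2 + log 2` collects the errors of the two approximations below
  obtain ⟨ε, hε, hε1, hεC⟩ : ∃ ε : ℝ, 0 < ε ∧ ε ≤ 1 ∧
      ∫ θ, Real.log (max (S θ) 0 + ε) ∂(frequencyMeasure d)
        < C - (2 * I + 2 + Real.log 2) := by
    by_contra! h
    exact hlog (isLogIntegrable_of_forall_lt_integral hS h)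
  obtain ⟨S', hS'm, hSS'⟩ := hS.aemeasurable
  -- `W = 1 + 1 / (S⁺ + ε)` makes `∫ S W - ∫ log W` very negative
  set W : (Fin d → ℝ) → ℝ := fun θ => 1 + (max (S' θ) 0 + ε)⁻¹ with hW
  have hden : ∀ θ, ε ≤ max (S' θ) 0 + ε := fun θ => by linarith [le_max_right (S' θ) 0]
  have hWm : Measurable W := (((hS'm.max measurable_const).add_const ε).inv).const_add 1
  have hW1 : ∀ θ, 1 ≤ W θ := fun θ => by
    have := inv_nonneg.2 (hε.le.trans (hden θ)); simp only [hW]; linarith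
  have hWb : ∀ θ, |W θ| ≤ 1 + ε⁻¹ := fun θ => by
    rw [abs_of_nonneg (by linarith [hW1 θ])]
    have := inv_anti₀ hε (hden θ)
    simp only [hW]; linarith
  have hρi : Integrable (fun θ => 1 + |S θ|) (frequencyMeasure d) :=
    (integrable_const 1).add hS.abs
  obtain ⟨g, hg⟩ := exists_continuousMap_integral_le hρi (fun θ => by positivity) hWm hWb one_pos
  set h : C(UnitAddTorus (Fin d), ℂ) := ⟨fun x => ((max (g x) 1 : ℝ) : ℂ), by fun_prop⟩ with hh
  have hmem : h ∈ closure
      (Submodule.span ℂ (Set.range (UnitAddTorus.mFourier (d := Fin d))) :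
        Set C(UnitAddTorus (Fin d), ℂ)) := by
    rw [← Submodule.topologicalClosure_coe, UnitAddTorus.span_mFourier_closure_eq_top]
    trivial
  obtain ⟨G, hG, hGh⟩ := Metric.mem_closure_iff.1 hmem (1 / 2) (by norm_num)
  have hGre : ∀ x, |(G x).re - max (g x) 1| ≤ 1 / 2 := by
    intro x
    have h1 : ‖G x - h x‖ ≤ 1 / 2 := by
      rw [← dist_eq_norm, dist_comm]
      exact (ContinuousMap.dist_apply_le_dist x).trans hGh.le
    have h2 := (Complex.abs_re_le_norm _).trans h1
    simpa [hh] using h2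
  have hGhalf : ∀ x, 1 / 2 ≤ (G x).re := fun x => by
    have := (abs_le.1 (hGre x)).1
    linarith [le_max_right (g x) 1]
  refine ⟨G, hG, hGhalf, ?_⟩
  have hGc : Continuous fun θ => (G (toTorus θ)).re := by fun_prop
  have hSG : Integrable (fun θ => S θ * (G (toTorus θ)).re) (frequencyMeasure d) := by
    refine hS.mul_bdd (c := ‖G‖) hGc.aestronglyMeasurable (Eventually.of_forall fun θ => ?_)
    exact (Complex.abs_re_le_norm _).trans (G.norm_coe_le_norm _)
  have hlG : Integrable (fun θ => Real.log (G (toTorus θ)).re) (frequencyMeasure d) :=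
    Continuous.integrable_frequencyMeasure
      (hGc.log fun θ => by linarith [hGhalf (toTorus θ)])
  have hgi : Integrable (fun θ => (1 + |S θ|) * |W θ - g (toTorus θ)|) (frequencyMeasure d) := by
    refine hρi.mul_bdd (c := 1 + ε⁻¹ + ‖g‖)
      ((hWm.sub (by fun_prop : Continuous fun θ => g (toTorus θ)).measurable).abs
        ).aestronglyMeasurable (Eventually.of_forall fun θ => ?_)
    rw [Real.norm_eq_abs, abs_abs]
    have := g.norm_coe_le_norm (toTorus θ)
    rw [Real.norm_eq_abs] at this
    exact (abs_sub _ _).trans (add_le_add (hWb θ) this)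
  have hli := integrable_log_max_add hS hε hε1
  rw [← integral_sub hSG hlG]
  have hpt : ∀ᵐ θ ∂(frequencyMeasure d), S θ * (G (toTorus θ)).re - Real.log (G (toTorus θ)).re
      ≤ (((1 + |S θ|) * |W θ - g (toTorus θ)| + Real.log (max (S θ) 0 + ε)) + 2 * |S θ|)
        + (1 + Real.log 2) := by
    filter_upwards [hSS'] with θ hθ
    set x := toTorus θ
    set c := max (g x) 1 with hc
    have hc1 : 1 ≤ c := le_max_right _ _
    have hcW : |W θ - c| ≤ |W θ - g x| := by
      have := abs_max_sub_max_le_abs (W θ) (g x) 1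
      rwa [max_eq_left (hW1 θ)] at this
    have hS0 := abs_nonneg (S θ)
    have e1 : S θ * (G x).re ≤ S θ * c + |S θ| * (1 / 2) := by
      have h1 : S θ * ((G x).re - c) ≤ |S θ| * (1 / 2) :=
        (le_abs_self _).trans (by rw [abs_mul]; gcongr; exact hGre x)
      linarith
    have e2 : Real.log c - Real.log 2 ≤ Real.log (G x).re := by
      rw [← Real.log_div (by linarith) (by norm_num)]
      refine Real.log_le_log (by linarith) ?_
      have := (abs_le.1 (hGre x)).1
      linarith
    have e3 : S θ * c ≤ S θ * W θ + |S θ| * |W θ - g x| := by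
      have h1 : S θ * (c - W θ) ≤ |S θ| * |W θ - g x| :=
        (le_abs_self _).trans (by rw [abs_mul, abs_sub_comm c]; gcongr)
      linarith
    have e4 : Real.log (W θ) - |W θ - g x| ≤ Real.log c := by
      have hW0 : 0 < W θ := by linarith [hW1 θ]
      have hc0 : 0 < c := by linarith
      have h1 := Real.log_le_sub_one_of_pos (div_pos hW0 hc0)
      rw [Real.log_div hW0.ne' hc0.ne'] at h1
      have h2 : W θ / c - 1 ≤ |W θ - c| := by
        rw [div_sub_one hc0.ne']
        refine (div_le_div_of_nonneg_right (le_abs_self _) hc0.le).trans ?_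
        exact div_le_self (abs_nonneg _) hc1
      linarith
    set D := max (S θ) 0 + ε with hD
    have hD0 : 0 < D := by have := le_max_right (S θ) 0; linarith
    have hWD : W θ = 1 + D⁻¹ := by simp only [hW, hD, hθ]
    have e5 : S θ * W θ ≤ |S θ| + 1 := by
      have h1 : S θ * D⁻¹ ≤ 1 := by
        rw [← div_eq_mul_inv, div_le_one hD0]
        linarith [le_max_left (S θ) 0]
      rw [hWD, mul_add, mul_one]
      linarith [le_abs_self (S θ)]
    have e6 : -Real.log D ≤ Real.log (W θ) := by
      rw [← Real.log_inv, hWD]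
      exact Real.log_le_log (inv_pos.2 hD0) (by linarith)
    have e7 : (1 + |S θ|) * |W θ - g x| = |W θ - g x| + |S θ| * |W θ - g x| := by ring
    linarith
  have hR1 := hgi.add hli
  have hR2 := hR1.add (hS.abs.const_mul 2)
  have hR3 := hR2.add (integrable_const (1 + Real.log 2))
  refine (integral_mono_ae (hSG.sub hlG) hR3 hpt).trans ?_
  have e1 := integral_add' hR2 (integrable_const (1 + Real.log 2))
  have e2 := integral_add' hR1 (hS.abs.const_mul 2)
  have e3 := integral_add' hgi hli
  rw [e2, e3, integral_const_mul, ← hI, integral_const, probReal_univ, one_smul] at e1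
  refine le_of_eq_of_le e1 ?_
  linarith

/-! ### The entropy of the field -/

theorem IsTranslationInvariant.integral_mul_eq {d : ℕ} {Ω : Type*} [MeasurableSpace Ω]
    {X : (Fin d → ℤ) → Ω → ℝ} {P : Measure Ω} (hX : IsTranslationInvariant X P)
    (i j : Fin d → ℤ) : ∫ ω, X i ω * X j ω ∂P = covarianceKernel X P (i - j) := by
  have hm : Measurable fun y : (Fin d → ℤ) → ℝ => y (i - j) * y 0 := by fun_prop
  have := ((hX j).comp hm).integral_eq
  simpa [Function.comp_def, covarianceKernel] using this

theorem IsTranslationInvariant.covarianceKernel_neg {d : ℕ} {Ω : Type*} [MeasurableSpace Ω]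
    {X : (Fin d → ℤ) → Ω → ℝ} {P : Measure Ω} (hX : IsTranslationInvariant X P)
    (m : Fin d → ℤ) : covarianceKernel X P (-m) = covarianceKernel X P m := by
  rw [← zero_sub, ← hX.integral_mul_eq, covarianceKernel]
  simp only [mul_comm]

open scoped MatrixOrder Matrix.Norms.L2Operator in
theorem Matrix.PosSemidef.exists_eq_transpose_mul_self {n : Type*} [Fintype n] [DecidableEq n]
    {M : Matrix n n ℝ} (hM : M.PosSemidef) : ∃ B : Matrix n n ℝ, M = B.transpose * B := by
  obtain ⟨B, hB⟩ := CStarAlgebra.nonneg_iff_eq_star_mul_self.mp hM.nonneg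
  exact ⟨B, by rw [hB, Matrix.star_eq_conjTranspose, Matrix.conjTranspose_eq_transpose_of_trivial]⟩

/-- The Gaussian bound for the precision matrix `toeplitz A w`: the entropy on `A` is at most
`(|A| log 2π - |A| ∫ log w + tr (C T)) / 2`, with `C` the covariance matrix and `T` the Toeplitz
matrix of `w`. -/
theorem fieldEntropy_le_of_symbol {d : ℕ} {Ω : Type*} [MeasurableSpace Ω] {P : Measure Ω}
    [IsProbabilityMeasure P] {X : (Fin d → ℤ) → Ω → ℝ} (hX : IsTranslationInvariant X P)
    (hL2 : ∀ i, MemLp (X i) 2 P) (A : Finset (Fin d → ℤ))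
    (hdens : HasPDF (fun ω (i : A) => X i ω) P volume) {w : (Fin d → ℝ) → ℝ} (hw : Continuous w)
    {δ : ℝ} (hδ : 0 < δ) (hwδ : ∀ θ, δ ≤ w θ) :
    fieldEntropy X P A ≤ (((A.card * Real.log (2 * Real.pi)
      - A.card * ∫ θ, Real.log (w θ) ∂(frequencyMeasure d)
      + ∑ i : A, ∑ j : A, covarianceKernel X P (i - j) * toeplitz A w i j) / 2 : ℝ) : EReal) := by
  have hpos := toeplitz_posDef A hw hδ hwδ
  obtain ⟨B, hB⟩ := hpos.posSemidef.exists_eq_transpose_mul_self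
  have hdet : (toeplitz A w).det = B.det ^ 2 := by
    rw [hB, Matrix.det_mul, Matrix.det_transpose, sq]
  have hBdet : B.det ≠ 0 := by
    intro h
    have := hpos.det_pos
    rw [hdet, h] at this
    simp at this
  have hlog : Real.log |B.det| = Real.log (toeplitz A w).det / 2 := by
    rw [hdet, Real.log_abs, Real.log_pow]; push_cast; ring
  have hquad : ∀ x : A → ℝ, ∑ i, (B.mulVec x) i ^ 2
      = ∑ i, ∑ j, toeplitz A w i j * (x i * x j) := by
    intro x
    have h1 : ∑ i, (B.mulVec x) i ^ 2 = x ⬝ᵥ (toeplitz A w).mulVec x := by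
      rw [hB, ← Matrix.mulVec_mulVec, Matrix.dotProduct_mulVec, Matrix.vecMul_transpose]
      simp [dotProduct, sq]
    rw [h1]
    simp only [dotProduct, Matrix.mulVec, Finset.mul_sum]
    refine Finset.sum_congr rfl fun i _ => Finset.sum_congr rfl fun j _ => ?_
    ring
  have hint : ∀ i j : A, Integrable (fun ω => toeplitz A w i j * (X i ω * X j ω)) P :=
    fun i j => ((hL2 i).integrable_mul (hL2 j)).const_mul _
  have hQ : Integrable (fun ω => ∑ i, (B.mulVec fun i : A => X i ω) i ^ 2) P := by
    simp only [hquad]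
    exact integrable_finsetSum _ fun i _ => integrable_finsetSum _ fun j _ => hint i j
  refine (fieldEntropy_le hdens hBdet hQ).trans (EReal.coe_le_coe_iff.2 ?_)
  have hE : ∫ ω, ∑ i, (B.mulVec fun i : A => X i ω) i ^ 2 ∂P
      = ∑ i : A, ∑ j : A, covarianceKernel X P (i - j) * toeplitz A w i j := by
    simp only [hquad]
    rw [integral_finsetSum _ fun i _ => integrable_finsetSum _ fun j _ => hint i j]
    refine Finset.sum_congr rfl fun i _ => ?_
    rw [integral_finsetSum _ fun j _ => hint i j]
    refine Finset.sum_congr rfl fun j _ => ?_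
    rw [integral_const_mul, hX.integral_mul_eq, mul_comm]
  have := card_mul_integral_log_le_log_det_toeplitz A hw hδ hwδ
  rw [hE, hlog]
  linarith

/-- The entropy per site tends to `-∞` along every Følner family of finite sets of sites. -/
theorem tendsto_fieldEntropy_div_card {d : ℕ} {Ω : Type*} [MeasurableSpace Ω] {P : Measure Ω}
    [IsProbabilityMeasure P] {X : (Fin d → ℤ) → Ω → ℝ} (hX : IsTranslationInvariant X P)
    (hL2 : ∀ i, MemLp (X i) 2 P) (hdens : HasJointDensities X P)
    {S : (Fin d → ℝ) → ℝ} (hS : IsStructureFunction S (covarianceKernel X P))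
    (hlog : ¬ IsLogIntegrable S) {ι : Type*} {l : Filter ι} {A : ι → Finset (Fin d → ℤ)}
    (hA0 : ∀ᶠ t in l, 0 < (A t).card) (hA : ∀ m : Fin d → ℤ, Tendsto
      (fun t => (((A t).filter fun i => i - m ∈ A t).card : ℝ) / (A t).card) l (𝓝 1)) :
    Tendsto (fun t => fieldEntropy X P (A t) / ((A t).card : EReal)) l (𝓝 ⊥) := by
  rw [EReal.tendsto_nhds_bot_iff_real]
  intro x
  obtain ⟨G, hG, hG1, hGC⟩ := exists_trigPolynomial_integral_le
    (integrable_frequencyMeasure_iff.2 hS.integrableOn) hlog (2 * x - Real.log (2 * Real.pi) - 1)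
  have htr := hS.tendsto_toeplitz_trace_div_card hX.covarianceKernel_neg hA hG
  filter_upwards [hA0, htr.eventually_lt_const (lt_add_one _)] with t ht0 ht
  have hn : (0 : ℝ) < (A t).card := by exact_mod_cast ht0
  have hle := fieldEntropy_le_of_symbol hX hL2 (A t) (hdens (A t))
    (w := fun θ => (G (toTorus θ)).re) (by fun_prop) one_half_pos fun θ => hG1 _
  have hn' : (((A t).card : ℕ) : EReal) = (((A t).card : ℝ) : EReal) := by simp
  rw [hn', EReal.div_lt_iff (by exact_mod_cast hn) (EReal.coe_ne_top _), ← EReal.coe_mul]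
  refine hle.trans_lt (EReal.coe_lt_coe_iff.2 ?_)
  rw [div_lt_iff₀ hn] at ht
  nlinarith

theorem HasSpectralGap.not_isLogIntegrable {d : ℕ} {S : (Fin d → ℝ) → ℝ}
    (h : HasSpectralGap S) : ¬ IsLogIntegrable S := by
  rintro ⟨hpos, -⟩
  obtain ⟨U, hU, hne, hsub, hzero⟩ := h
  have h1 : ∀ᵐ θ ∂(volume.restrict U), 0 < S θ := ae_mono (Measure.restrict_mono hsub le_rfl) hpos
  have : (ae (volume.restrict U)).NeBot := by
    rw [ae_neBot, Ne, Measure.restrict_eq_zero]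
    exact (hU.measure_pos volume hne).ne'
  obtain ⟨θ, h2, h3⟩ := (h1.and hzero).exists
  exact h2.ne' h3

end

theorem theorem6 {d : ℕ} (hd : 0 < d) {Ω : Type*} [MeasurableSpace Ω] (P : Measure Ω)
    [IsProbabilityMeasure P] (X : (Fin d → ℤ) → Ω → ℝ)
    (hX : IsTranslationInvariant X P)
    (hL2 : ∀ i, MemLp (X i) 2 P) (hmean : ∀ i, ∫ ω, X i ω ∂P = 0)
    (hvar : ∀ i, variance (X i) P = 1)
    (hdens : HasJointDensities X P)
    (S : (Fin d → ℝ) → ℝ) (hS : IsStructureFunction S (covarianceKernel X P))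
    (Λ : Set (EuclideanSpace ℝ (Fin d))) (hΛ : IsPositivelyCurvedDomain Λ) :
    (HasSpectralGap S →
      Tendsto (fun L : ℝ => fieldEntropy X P (sites Λ hΛ.isBounded L) /
        ((sites Λ hΛ.isBounded L).card : EReal)) atTop (𝓝 ⊥)) ∧
    (¬ IsLogIntegrable S →
      Tendsto (fun L : ℝ => fieldEntropy X P (sites Λ hΛ.isBounded L) /
        ((sites Λ hΛ.isBounded L).card : EReal)) atTop (𝓝 ⊥)) := by
  have hfol := tendsto_card_inter_translate_div_card hΛ.isOpen hΛ.isConnected.nonempty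
    hΛ.isBounded (volume_frontier_eq_zero hΛ.isOpen hΛ.boundary_C2)
  have key := fun h => tendsto_fieldEntropy_div_card hX hL2 hdens hS h hfol.1 hfol.2
  exact ⟨fun h => key h.not_isLogIntegrable, key⟩
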